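/- Let $n\ge 2$ and let $N\subset\mathbb R^p$ be a compact $C^\infty$ Riemannian manifold isometrically embedded in $\mathbb R^p$. Let $\varphi:\mathbb R^n\to N$ be a homogeneous degree zero minimizer. That is: (i) $\varphi\in W^{1,2}_{\mathrm{loc}}(\mathbb R^n;\mathbb R^p)$ and $\varphi(x)\in N$ for a.e. $x$; (ii) $\varphi$ is energy minimizing: for every ball $B_\rho(y)\subset\mathbb R^n$ one has $\int_{B_\rho(y)}|D\varphi|^2\le\int_{B_\rho(y)}|Dw|^2$ for every $w\in W^{1,2}(B_\rho(y);\mathbb R^p)$ with $w(x)\in N$ for a.e. $x\in B_\rho(y)$ and $w=\varphi$ a.e. in $B_\rho(y)$ near $\partial B_\rho(y)$; (iii) for every $\lambda>0$, $\varphi(\lambda x)=\varphi(x)$ for a.e. $x\in\mathbb R^n$. Here $D\varphi=(D_i\varphi^j)$ is the weak derivative and $|D\varphi|^2=\sum_{i,j}(D_i\varphi^j)^2$. Then for every $y\in\mathbb R^n$ the density $$\Theta_\varphi(y)=\lim_{\rho\downarrow0}\rho^{2-n}\int_{B_\rho(y)}|D\varphi|^2$$ exists and is finite, and $$\Theta_\varphi(y)\le\Theta_\varphi(0),$$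 so the density attains its maximum at the origin. More precisely, for every $y\in\mathbb R^n$, $$2\int_{\mathbb R^n}R_y^{2-n}\left|\frac{\partial\varphi}{\partial R_y}\right|^2dx+\Theta_\varphi(y)\le\Theta_\varphi(0),$$ where $R_y(x)=|x-y|$ and $\frac{\partial\varphi}{\partial R_y}(x)=|x-y|^{-1}\sum_{i=1}^n(x_i-y_i)D_i\varphi(x)$; in particular the integral is finite. -/

import Mathlib

open MeasureTheory Filter Topology Set Metric
open scoped ContDiff Manifold

noncomputable section

/-- `ℝⁿ` with its Euclidean norm. -/
abbrev Euc (n : ℕ) : Type := EuclideanSpace ℝ (Fin n)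

/-- `G i j` is the weak partial derivative `D_i u^j` on the open set `Ω`, for all `i`, `j`. -/
structure HasWeakDeriv {n p : ℕ} (Ω : Set (Euc n)) (u : Euc n → Euc p)
    (G : Fin n → Fin p → Euc n → ℝ) : Prop where
  locInt : ∀ j, LocallyIntegrableOn (fun x => u x j) Ω
  locInt_deriv : ∀ i j, LocallyIntegrableOn (G i j) Ω
  integral_eq : ∀ η : Euc n → ℝ, ContDiff ℝ ∞ η → HasCompactSupport η → tsupport η ⊆ Ω →
    ∀ i j, ∫ x in Ω, η x * G i j x =
      - ∫ x in Ω, u x j * fderiv ℝ η x (EuclideanSpace.single i 1)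

/-- Weak derivatives are unique up to null sets. -/
theorem HasWeakDeriv.ae_eq {n p : ℕ} {Ω : Set (Euc n)} (hΩ : IsOpen Ω) {u : Euc n → Euc p}
    {G G' : Fin n → Fin p → Euc n → ℝ} (h : HasWeakDeriv Ω u G) (h' : HasWeakDeriv Ω u G')
    (i : Fin n) (j : Fin p) : ∀ᵐ x ∂(volume.restrict Ω), G i j x = G' i j x := by
  have key : ∀ᵐ x ∂(volume : Measure (Euc n)), x ∈ Ω → G i j x - G' i j x = 0 := by
    refine hΩ.ae_eq_zero_of_integral_contDiff_smul_eq_zero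
      ((h.locInt_deriv i j).sub (h'.locInt_deriv i j)) ?_
    intro η hη hc hs
    have int : ∀ f : Euc n → ℝ, LocallyIntegrableOn f Ω →
        Integrable (fun x => η x * f x) volume := by
      intro f hf
      have h1 : IntegrableOn f (tsupport η) volume :=
        (hf.mono_set hs).integrableOn_isCompact hc
      have h2 : IntegrableOn (fun x => η x * f x) (tsupport η) volume :=
        h1.continuousOn_mul hη.continuous.continuousOn hc
      refine (integrableOn_iff_integrable_of_support_subset ?_).1 h2
      intro x hx
      exact subset_tsupport _ (left_ne_zero_of_mul hx)
    have res : ∀ f : Euc n → ℝ, ∫ x in Ω, η x * f x = ∫ x, η x * f x := by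
      intro f
      refine setIntegral_eq_integral_of_forall_compl_eq_zero ?_
      intro x hx
      have : η x = 0 := by
        by_contra hne
        exact hx (hs (subset_tsupport _ hne))
      simp [this]
    have e := (h.integral_eq η hη hc hs i j).trans (h'.integral_eq η hη hc hs i j).symm
    rw [res, res] at e
    simp only [smul_eq_mul, mul_sub]
    rw [integral_sub (int _ (h.locInt_deriv i j)) (int _ (h'.locInt_deriv i j)), e, sub_self]
  rw [ae_restrict_iff' hΩ.measurableSet]
  filter_upwards [key] with x hx hxΩ
  exact sub_eq_zero.1 (hx hxΩ)

open Classical in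
/-- The weak derivative `Du = (D_i u^j)` of `u` on `Ω` (zero if `u` is not weakly
differentiable on `Ω`). -/
def weakDeriv {n p : ℕ} (Ω : Set (Euc n)) (u : Euc n → Euc p) : Fin n → Fin p → Euc n → ℝ :=
  if h : ∃ G, HasWeakDeriv Ω u G then h.choose else 0

/-- `u ∈ W^{1,2}(Ω; N)`. -/
def MemW12 {n p : ℕ} (Ω : Set (Euc n)) (N : Set (Euc p)) (u : Euc n → Euc p) : Prop :=
  (∃ G, HasWeakDeriv Ω u G ∧ MemLp u 2 (volume.restrict Ω) ∧
      ∀ i j, MemLp (G i j) 2 (volume.restrict Ω)) ∧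
    ∀ᵐ x ∂(volume.restrict Ω), u x ∈ N

/-- `u ∈ W^{1,2}_loc(Ω; N)`. -/
def MemW12Loc {n p : ℕ} (Ω : Set (Euc n)) (N : Set (Euc p)) (u : Euc n → Euc p) : Prop :=
  (∃ G, HasWeakDeriv Ω u G ∧ ∀ K ⊆ Ω, IsCompact K →
      MemLp u 2 (volume.restrict K) ∧ ∀ i j, MemLp (G i j) 2 (volume.restrict K)) ∧
    ∀ᵐ x ∂(volume.restrict Ω), u x ∈ N

/-- The Dirichlet energy `∫_Ω |Du|²`, with `|Du|² = ∑ i j, (D_i u^j)²`. -/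
def energy {n p : ℕ} (Ω : Set (Euc n)) (u : Euc n → Euc p) : ℝ :=
  ∫ x in Ω, ∑ i, ∑ j, (weakDeriv Ω u i j x) ^ 2

/-- `u` is an energy minimizing map from `Ω` to `N`: on every ball `B` with closure in `Ω` it has
least energy among the maps in `W^{1,2}(B; N)` that agree with `u` near `∂B`. -/
def IsEnergyMinimizing {n p : ℕ} (Ω : Set (Euc n)) (N : Set (Euc p)) (u : Euc n → Euc p) : Prop :=
  MemW12Loc Ω N u ∧
    ∀ (y : Euc n) (ρ : ℝ), 0 < ρ → closedBall y ρ ⊆ Ω →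
      ∀ w : Euc n → Euc p, MemW12 (ball y ρ) N w →
        (∃ U : Set (Euc n), IsOpen U ∧ sphere y ρ ⊆ U ∧
          ∀ᵐ x ∂(volume.restrict (ball y ρ ∩ U)), w x = u x) →
        energy (ball y ρ) u ≤ energy (ball y ρ) w

/-- `φ : ℝⁿ → N` is a homogeneous degree zero minimizer. Since `φ` is a Sobolev map, the
homogeneity is only required almost everywhere for each dilation. -/
def IsDegreeZeroMinimizer {n p : ℕ} (N : Set (Euc p)) (φ : Euc n → Euc p) : Prop :=
  IsEnergyMinimizing univ N φ ∧ ∀ l : ℝ, 0 < l → ∀ᵐ x : Euc n, φ (l • x) = φ x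

/-- The scaled energy `ρ^{2-n} ∫_{B_ρ(y)} |Du|²`. -/
def scaledEnergy {n p : ℕ} (u : Euc n → Euc p) (y : Euc n) (ρ : ℝ) : ℝ :=
  ρ ^ (2 - (n : ℤ)) * energy (ball y ρ) u

/-- The density `Θ_u(y) = lim_{ρ ↓ 0} ρ^{2-n} ∫_{B_ρ(y)} |Du|²`. -/
def density {n p : ℕ} (u : Euc n → Euc p) (y : Euc n) : ℝ :=
  limUnder (𝓝[>] (0 : ℝ)) (scaledEnergy u y)

/-- The radial derivative `∂u/∂R_y = |x - y|⁻¹ (x - y) · Du` of a map on `ℝⁿ`, where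
`R_y(x) = |x - y|`. -/
def radialDeriv {n p : ℕ} (u : Euc n → Euc p) (y : Euc n) (x : Euc n) : Euc p :=
  WithLp.toLp 2 fun j => ‖x - y‖⁻¹ * ∑ i, (x i - y i) * weakDeriv univ u i j x

end

noncomputable section

/-! The theorem combines the monotonicity formula at `y` with the scale invariance of the energy at
the origin.

Minimality is used only against domain deformations. If `g` inverts `x ↦ x + s ζ(x)`, then `u ∘ g`
still takes values in the target almost everywhere, and it agrees with `u` near the boundary of a
ball containing the support of `ζ`. Changing variables moves the deformation into smooth
coefficients. Expanding these to first order in `s`, with both signs of `s`, gives the stationarity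
identity `IsEnergyMinimizing.integral_energyCoeffLin_eq_zero`. The Sobolev chain rule this needs is
`SmoothInverse.hasWeakDeriv_comp`.

For `ζ = η(r²)(x - y)`, with `r = |x - y|` and `m = (n - 2) / 2`, stationarity involves `m η + t η'`
at `t = r²`. Taking `η' = -t ^ (-m - 1)` on `(σ², ρ²)` and `η = 0` beyond `ρ²` makes this
combination constant on each of the two regions `t < σ²` and `σ² < t < ρ²`. The energy terms become
a difference of scaled energies and the remaining term is the weighted radial energy of the annulus.
This is `IsEnergyMinimizing.scaledEnergy_eq_add`.

Homogeneity makes the scaled energy at `0` constant, equal to the density there. Since `B_ρ(y)` lies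
in `B_{ρ+|y|}(0)`, the scaled energy at `y` is at most `(1 + |y|/ρ) ^ (n - 2)` times the density at
`0`. Monotonicity on annuli that exhaust space then bounds twice the radial integral plus the
density at `y` by the limit of this quantity, the density at `0`. -/

theorem sum_coord_smul_single {n : ℕ} (v : Euc n) :
    ∑ k, v k • EuclideanSpace.single k (1 : ℝ) = v := by
  ext i
  simp [Pi.single_apply]

theorem map_eq_sum_coord {n : ℕ} {F : Type*} [NormedAddCommGroup F] [NormedSpace ℝ F]
    (L : Euc n →L[ℝ] F) (v : Euc n) :
    L v = ∑ k, v k • L (EuclideanSpace.single k 1) := by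
  conv_lhs => rw [← sum_coord_smul_single v]
  simp [map_sum]

theorem ContinuousLinearMap.contDiff_det {E : Type*} [NormedAddCommGroup E] [NormedSpace ℝ E]
    [FiniteDimensional ℝ E] {m : WithTop ℕ∞} :
    ContDiff ℝ m (fun A : E →L[ℝ] E => A.det) := by
  have h : (fun A : E →L[ℝ] E => A.det) = fun A : E →L[ℝ] E =>
      (LinearMap.toMatrix (Module.finBasis ℝ E) (Module.finBasis ℝ E)
        (A.toLinearMap)).det := by
    funext A
    rw [LinearMap.det_toMatrix]
  rw [h]
  simp only [Matrix.det_apply]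
  refine ContDiff.sum fun σ _ => ContDiff.const_smul _ (contDiff_prod fun i _ => ?_)
  let l : (E →L[ℝ] E) →ₗ[ℝ] ℝ :=
    { toFun := fun A => LinearMap.toMatrix (Module.finBasis ℝ E) (Module.finBasis ℝ E)
        (A : E →ₗ[ℝ] E) (σ i) i
      map_add' := fun A B => by simp
      map_smul' := fun c A => by simp }
  exact (LinearMap.toContinuousLinearMap l).contDiff

/-- `f` and `g` are mutually inverse smooth diffeomorphisms of `ℝⁿ`. -/
structure SmoothInverse {n : ℕ} (f g : Euc n → Euc n) : Prop where
  smooth : ContDiff ℝ ∞ f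
  smooth_inv : ContDiff ℝ ∞ g
  left_inv : Function.LeftInverse g f
  right_inv : Function.RightInverse g f

/-! ### Change of variables under a smooth diffeomorphism -/

namespace SmoothInverse

variable {n : ℕ} {f g : Euc n → Euc n}

theorem symm (h : SmoothInverse f g) : SmoothInverse g f :=
  ⟨h.smooth_inv, h.smooth, h.right_inv, h.left_inv⟩

theorem hasFDerivAt (h : SmoothInverse f g) (x : Euc n) : HasFDerivAt f (fderiv ℝ f x) x :=
  (h.smooth.differentiable (by simp) x).hasFDerivAt

theorem fderiv_comp_fderiv (h : SmoothInverse f g) (x : Euc n) :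
    (fderiv ℝ g (f x)).comp (fderiv ℝ f x) = ContinuousLinearMap.id ℝ (Euc n) := by
  have h1 := (h.symm.hasFDerivAt (f x)).comp x (h.hasFDerivAt x)
  have h2 : g ∘ f = id := funext h.left_inv
  rw [h2] at h1
  exact h1.unique (hasFDerivAt_id x)

theorem det_ne_zero (h : SmoothInverse f g) (x : Euc n) : (fderiv ℝ f x).det ≠ 0 := by
  intro h0
  have h1 := congrArg ContinuousLinearMap.det (h.fderiv_comp_fderiv x)
  have h2 : ((fderiv ℝ g (f x)).comp (fderiv ℝ f x)).det =
      (fderiv ℝ g (f x)).det * (fderiv ℝ f x).det :=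
    LinearMap.det_comp _ _
  have h3 : (ContinuousLinearMap.id ℝ (Euc n)).det = 1 := LinearMap.det_id
  rw [h2, h0, h3] at h1
  simp at h1

theorem contDiff_fderiv (h : SmoothInverse f g) : ContDiff ℝ ∞ (fderiv ℝ f) :=
  h.smooth.fderiv_right (by simp)

/-- The absolute value is smooth away from zero, a value the Jacobian determinant never takes. The
test functions `piola` contain this factor and must be smooth. -/
theorem contDiff_abs_det (h : SmoothInverse f g) :
    ContDiff ℝ ∞ fun x => |(fderiv ℝ f x).det| := by
  rw [contDiff_iff_contDiffAt]
  intro x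
  exact ContDiffAt.abs
    ((ContinuousLinearMap.contDiff_det.comp h.contDiff_fderiv).contDiffAt) (h.det_ne_zero x)

theorem setIntegral_comp (h : SmoothInverse f g) {s : Set (Euc n)} (hs : MeasurableSet s)
    (u : Euc n → ℝ) :
    ∫ x in f '' s, u x = ∫ x in s, |(fderiv ℝ f x).det| * u (f x) :=
  integral_image_eq_integral_abs_det_fderiv_smul volume hs
    (fun x _ => (h.hasFDerivAt x).hasFDerivWithinAt) h.left_inv.injective.injOn u

theorem integral_comp (h : SmoothInverse f g) (u : Euc n → ℝ) :
    ∫ x, u x = ∫ x, |(fderiv ℝ f x).det| * u (f x) := by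
  have := h.setIntegral_comp MeasurableSet.univ u
  rwa [image_univ, h.right_inv.surjective.range_eq, setIntegral_univ, setIntegral_univ] at this

theorem image_eq_preimage (h : SmoothInverse f g) (s : Set (Euc n)) : f '' s = g ⁻¹' s :=
  congrFun (image_eq_preimage_of_inverse h.left_inv h.right_inv) s

theorem measurable (h : SmoothInverse f g) : Measurable f := h.smooth.continuous.measurable

/-- The Jacobian of the inverse controls the pushed-forward volume and is bounded on the compact
image. This domination carries `MemLp` through composition. -/
theorem map_restrict_le (h : SmoothInverse f g) {K : Set (Euc n)} (hK : IsCompact K) :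
    ∃ C : ENNReal, C ≠ ⊤ ∧
      Measure.map f (volume.restrict K) ≤ C • volume.restrict (f '' K) := by
  have hK' : IsCompact (f '' K) := hK.image h.smooth.continuous
  obtain ⟨C, hC⟩ := hK'.exists_bound_of_continuousOn
    (f := fun x => (fderiv ℝ g x).det)
    ((ContinuousLinearMap.contDiff_det (m := ∞).comp
      h.symm.contDiff_fderiv).continuous.continuousOn)
  refine ⟨ENNReal.ofReal C, ENNReal.ofReal_ne_top, ?_⟩
  rw [Measure.le_iff]
  intro s hs
  rw [Measure.map_apply h.measurable hs, Measure.smul_apply,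
    Measure.restrict_apply (h.measurable hs), Measure.restrict_apply hs]
  have e : f ⁻¹' s ∩ K = g '' (s ∩ f '' K) := by
    rw [h.symm.image_eq_preimage, preimage_inter, preimage_image_eq _ h.left_inv.injective]
  rw [e]
  have hm : MeasurableSet (s ∩ f '' K) := hs.inter hK'.measurableSet
  refine (addHaar_image_le_lintegral_abs_det_fderiv volume hm
    (fun x _ => (h.symm.hasFDerivAt x).hasFDerivWithinAt)).trans ?_
  calc ∫⁻ x in s ∩ f '' K, ENNReal.ofReal |(fderiv ℝ g x).det|
      ≤ ∫⁻ _ in s ∩ f '' K, ENNReal.ofReal C := by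
        refine setLIntegral_mono measurable_const fun x hx => ?_
        exact ENNReal.ofReal_le_ofReal (hC x hx.2)
    _ = _ := by simp

theorem quasiMeasurePreserving (h : SmoothInverse f g) :
    Measure.QuasiMeasurePreserving f volume volume := by
  refine ⟨h.measurable, ?_⟩
  refine Measure.AbsolutelyContinuous.mk fun s hs h0 => ?_
  rw [Measure.map_apply h.measurable hs, ← h.symm.image_eq_preimage]
  exact addHaar_image_eq_zero_of_differentiableOn_of_addHaar_eq_zero volume
    (h.smooth_inv.differentiable (by simp)).differentiableOn h0

theorem memLp_comp (h : SmoothInverse f g) {K : Set (Euc n)} (hK : IsCompact K)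
    {F : Type*} [NormedAddCommGroup F] {u : Euc n → F} {q : ENNReal}
    (hu : MemLp u q (volume.restrict (f '' K))) :
    MemLp (fun x => u (f x)) q (volume.restrict K) := by
  obtain ⟨C, hC, hle⟩ := h.map_restrict_le hK
  exact (hu.of_measure_le_smul hC hle).comp_of_map h.measurable.aemeasurable

theorem locallyIntegrable_comp (h : SmoothInverse f g) {u : Euc n → ℝ}
    (hu : LocallyIntegrable u) : LocallyIntegrable fun x => u (f x) := by
  rw [locallyIntegrable_iff]
  intro K hK
  rw [IntegrableOn, ← memLp_one_iff_integrable]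
  exact h.memLp_comp hK (memLp_one_iff_integrable.2
    (hu.integrableOn_isCompact (hK.image h.smooth.continuous)))

end SmoothInverse

/-! ### The Piola identity and the Sobolev chain rule -/

theorem integrable_mul_of_hasCompactSupport {n : ℕ} {η u : Euc n → ℝ} (hu : LocallyIntegrable u)
    (hη : Continuous η) (hc : HasCompactSupport η) : Integrable fun x => η x * u x := by
  have := hu.integrable_smul_left_of_hasCompactSupport hη hc
  simpa using this

theorem integral_mul_fderiv_eq_neg {n : ℕ} {η u : Euc n → ℝ} (hu : ContDiff ℝ ∞ u)
    (hη : ContDiff ℝ ∞ η) (hc : HasCompactSupport η) (v : Euc n) :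
    ∫ x, u x * fderiv ℝ η x v = - ∫ x, η x * fderiv ℝ u x v := by
  have hu' : Continuous fun x => fderiv ℝ u x v :=
    (hu.continuous_fderiv (by simp)).clm_apply continuous_const
  have hη' : Continuous fun x => fderiv ℝ η x v :=
    (hη.continuous_fderiv (by simp)).clm_apply continuous_const
  have hc' : HasCompactSupport fun x => fderiv ℝ η x v := hc.fderiv_apply (𝕜 := ℝ) v
  rw [integral_mul_fderiv_eq_neg_fderiv_mul_of_integrable]
  · simp only [mul_comm]
  · exact (hu'.mul hη.continuous).integrable_of_hasCompactSupport hc.mul_left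
  · exact (hu.continuous.mul hη').integrable_of_hasCompactSupport hc'.mul_left
  · exact (hu.continuous.mul hη.continuous).integrable_of_hasCompactSupport hc.mul_left
  · exact fun x _ => hu.differentiable (by simp) x
  · exact fun x _ => hη.differentiable (by simp) x

namespace SmoothInverse

variable {n : ℕ} {f g : Euc n → Euc n}

/-- The cofactor test functions: the Piola transform of the field `η ∂ᵢ`. -/
def piola (f g : Euc n → Euc n) (η : Euc n → ℝ) (i k : Fin n) (y : Euc n) : ℝ :=
  |(fderiv ℝ g y).det| * η (g y) * fderiv ℝ f (g y) (EuclideanSpace.single i 1) k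

theorem contDiff_piola (h : SmoothInverse f g) {η : Euc n → ℝ} (hη : ContDiff ℝ ∞ η)
    (i k : Fin n) : ContDiff ℝ ∞ (piola f g η i k) := by
  have h1 : ContDiff ℝ ∞ fun y => fderiv ℝ f (g y) (EuclideanSpace.single i 1) :=
    (h.contDiff_fderiv.comp h.smooth_inv).clm_apply contDiff_const
  have h2 : ContDiff ℝ ∞ fun y => fderiv ℝ f (g y) (EuclideanSpace.single i 1) k :=
    (contDiff_euclidean.1 h1) k
  exact (h.symm.contDiff_abs_det.mul (hη.comp h.smooth_inv)).mul h2

theorem hasCompactSupport_comp (h : SmoothInverse f g) {η : Euc n → ℝ}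
    (hc : HasCompactSupport η) : HasCompactSupport fun y => η (g y) := by
  let e : Euc n ≃ₜ Euc n :=
    { toFun := g
      invFun := f
      left_inv := h.right_inv
      right_inv := h.left_inv
      continuous_toFun := h.smooth_inv.continuous
      continuous_invFun := h.smooth.continuous }
  exact hc.comp_homeomorph e

theorem hasCompactSupport_piola (h : SmoothInverse f g) {η : Euc n → ℝ}
    (hc : HasCompactSupport η) (i k : Fin n) : HasCompactSupport (piola f g η i k) :=
  ((h.hasCompactSupport_comp hc).mul_left).mul_right

/-- The Piola identity, tested against `η`. -/
theorem sum_fderiv_piola_ae (h : SmoothInverse f g) {η : Euc n → ℝ} (hη : ContDiff ℝ ∞ η)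
    (hc : HasCompactSupport η) (i : Fin n) :
    ∀ᵐ y : Euc n, ∑ k, fderiv ℝ (piola f g η i k) y (EuclideanSpace.single k 1) =
      |(fderiv ℝ g y).det| * fderiv ℝ η (g y) (EuclideanSpace.single i 1) := by
  have hcont : ∀ k, Continuous fun y =>
      fderiv ℝ (piola f g η i k) y (EuclideanSpace.single k 1) := fun k =>
    ((h.contDiff_piola hη i k).continuous_fderiv (by simp)).clm_apply continuous_const
  have hη' : Continuous fun x => fderiv ℝ η x (EuclideanSpace.single i 1) :=
    (hη.continuous_fderiv (by simp)).clm_apply continuous_const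
  -- Duality avoids differentiating cofactors: after pairing with a test function `θ`, two
  -- integrations by parts and two changes of variables turn one side into the other.
  refine ae_eq_of_integral_contDiff_smul_eq
    (continuous_finsetSum _ fun k _ => hcont k).locallyIntegrable
    (h.symm.contDiff_abs_det.continuous.mul
      (hη'.comp h.smooth_inv.continuous)).locallyIntegrable ?_
  intro θ hθ hθc
  simp only [smul_eq_mul, Finset.mul_sum]
  have hθ' : ∀ v, Continuous fun x => fderiv ℝ θ x v := fun v =>
    (hθ.continuous_fderiv (by simp)).clm_apply continuous_const
  calc ∫ y, ∑ k, θ y * fderiv ℝ (piola f g η i k) y (EuclideanSpace.single k 1)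
      = ∑ k, ∫ y, θ y * fderiv ℝ (piola f g η i k) y (EuclideanSpace.single k 1) :=
        integral_finsetSum _ fun k _ =>
          (hθ.continuous.mul (hcont k)).integrable_of_hasCompactSupport hθc.mul_right
    _ = ∑ k, - ∫ y, piola f g η i k y * fderiv ℝ θ y (EuclideanSpace.single k 1) :=
        Finset.sum_congr rfl fun k _ => integral_mul_fderiv_eq_neg hθ (h.contDiff_piola hη i k)
          (h.hasCompactSupport_piola hc i k) _
    _ = - ∫ y, ∑ k, piola f g η i k y * fderiv ℝ θ y (EuclideanSpace.single k 1) := by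
        rw [Finset.sum_neg_distrib, integral_finsetSum]
        exact fun k _ => ((h.contDiff_piola hη i k).continuous.mul
          (hθ' _)).integrable_of_hasCompactSupport (h.hasCompactSupport_piola hc i k).mul_right
    _ = - ∫ y, |(fderiv ℝ g y).det| *
          (fun x => η x * fderiv ℝ (θ ∘ f) x (EuclideanSpace.single i 1)) (g y) := by
        congr 2 with y
        have e : fderiv ℝ (θ ∘ f) (g y) (EuclideanSpace.single i 1) =
            fderiv ℝ θ y (fderiv ℝ f (g y) (EuclideanSpace.single i 1)) := by
          rw [fderiv_comp _ (hθ.differentiable (by simp) _) (h.smooth.differentiable (by simp) _),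
            h.right_inv y]
          rfl
        simp only
        rw [e, map_eq_sum_coord (fderiv ℝ θ y), Finset.mul_sum, Finset.mul_sum]
        refine Finset.sum_congr rfl fun k _ => ?_
        simp only [piola, smul_eq_mul]
        ring
    _ = - ∫ x, η x * fderiv ℝ (θ ∘ f) x (EuclideanSpace.single i 1) := by
        exact congrArg Neg.neg (h.symm.integral_comp
          (fun x => η x * fderiv ℝ (θ ∘ f) x (EuclideanSpace.single i 1))).symm
    _ = ∫ x, (θ ∘ f) x * fderiv ℝ η x (EuclideanSpace.single i 1) := by
        rw [integral_mul_fderiv_eq_neg (hθ.comp h.smooth) hη hc]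
    _ = ∫ y, |(fderiv ℝ g y).det| *
          (fun x => (θ ∘ f) x * fderiv ℝ η x (EuclideanSpace.single i 1)) (g y) :=
        h.symm.integral_comp _
    _ = _ := by
        congr 1 with y
        simp only [Function.comp, h.right_inv y]
        ring

/-- The chain rule for the composition of a Sobolev map with a diffeomorphism. -/
theorem hasWeakDeriv_comp {p : ℕ} (h : SmoothInverse f g) {u : Euc n → Euc p}
    {G : Fin n → Fin p → Euc n → ℝ} (hu : HasWeakDeriv univ u G) :
    HasWeakDeriv univ (fun x => u (f x))
      (fun i j x => ∑ k, G k j (f x) * fderiv ℝ f x (EuclideanSpace.single i 1) k) := by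
  have hL : ∀ j, LocallyIntegrable fun x => u x j := fun j =>
    locallyIntegrableOn_univ.1 (hu.locInt j)
  have hG : ∀ i j, LocallyIntegrable (G i j) := fun i j =>
    locallyIntegrableOn_univ.1 (hu.locInt_deriv i j)
  have hDf : ∀ i k, Continuous fun x => fderiv ℝ f x (EuclideanSpace.single i 1) k := fun i k =>
    ((contDiff_euclidean.1 (h.contDiff_fderiv.clm_apply contDiff_const)) k).continuous
  have hterm : ∀ i j k, LocallyIntegrable fun x =>
      G k j (f x) * fderiv ℝ f x (EuclideanSpace.single i 1) k := by
    intro i j k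
    have h1 := h.locallyIntegrable_comp (hG k j)
    rw [locallyIntegrable_iff] at h1 ⊢
    exact fun K hK => (h1 K hK).mul_continuousOn (hDf i k).continuousOn hK
  refine ⟨fun j => locallyIntegrableOn_univ.2 (h.locallyIntegrable_comp (hL j)),
    fun i j => locallyIntegrableOn_univ.2 ?_, ?_⟩
  · exact locallyIntegrable_finsetSum Finset.univ (fun k _ => hterm i j k)
  intro η hη hc _ i j
  simp only [setIntegral_univ]
  have hint : ∀ k, ∫ y, piola f g η i k y * G k j y =
      - ∫ y, u y j * fderiv ℝ (piola f g η i k) y (EuclideanSpace.single k 1) := fun k => by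
    simpa using hu.integral_eq _ (h.contDiff_piola hη i k) (h.hasCompactSupport_piola hc i k)
      (subset_univ _) k j
  -- In the variable `y = f x`, the factor multiplying `G k j y` is exactly `piola f g η i k`, an
  -- admissible test function for `u`; the Piola identity then evaluates its divergence.
  calc ∫ x, η x * ∑ k, G k j (f x) * fderiv ℝ f x (EuclideanSpace.single i 1) k
      = ∫ y, |(fderiv ℝ g y).det| * (fun x => η x *
          ∑ k, G k j (f x) * fderiv ℝ f x (EuclideanSpace.single i 1) k) (g y) :=
        h.symm.integral_comp _
    _ = ∫ y, ∑ k, piola f g η i k y * G k j y := by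
        congr 1 with y
        simp only [h.right_inv y, Finset.mul_sum, piola]
        exact Finset.sum_congr rfl fun k _ => by ring
    _ = ∑ k, ∫ y, piola f g η i k y * G k j y :=
        integral_finsetSum _ fun k _ => integrable_mul_of_hasCompactSupport (hG k j)
          (h.contDiff_piola hη i k).continuous (h.hasCompactSupport_piola hc i k)
    _ = - ∑ k, ∫ y, u y j * fderiv ℝ (piola f g η i k) y (EuclideanSpace.single k 1) := by
        rw [← Finset.sum_neg_distrib]
        exact Finset.sum_congr rfl fun k _ => hint k
    _ = - ∫ y, u y j * ∑ k, fderiv ℝ (piola f g η i k) y (EuclideanSpace.single k 1) := by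
        simp only [Finset.mul_sum]
        rw [integral_finsetSum]
        intro k _
        have := integrable_mul_of_hasCompactSupport (hL j)
          (((h.contDiff_piola hη i k).continuous_fderiv (by simp)).clm_apply continuous_const)
          ((h.hasCompactSupport_piola hc i k).fderiv_apply (𝕜 := ℝ) (EuclideanSpace.single k 1))
        simpa only [mul_comm] using this
    _ = - ∫ y, |(fderiv ℝ g y).det| *
          (fun x => u (f x) j * fderiv ℝ η x (EuclideanSpace.single i 1)) (g y) := by
        congr 1
        refine integral_congr_ae ?_
        filter_upwards [h.sum_fderiv_piola_ae hη hc i] with y hy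
        simp only [hy, h.right_inv y]
        ring
    _ = _ := congrArg Neg.neg (h.symm.integral_comp
          (fun x => u (f x) j * fderiv ℝ η x (EuclideanSpace.single i 1))).symm

end SmoothInverse


/-! ### Locality and uniqueness of weak derivatives -/

section WeakDerivative

variable {n p : ℕ} {Ω Ω' : Set (Euc n)} {u v : Euc n → Euc p} {G : Fin n → Fin p → Euc n → ℝ}

theorem HasWeakDeriv.weakDeriv (h : HasWeakDeriv Ω u G) : HasWeakDeriv Ω u (weakDeriv Ω u) := by
  have h' : ∃ G, HasWeakDeriv Ω u G := ⟨G, h⟩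
  rw [_root_.weakDeriv, dif_pos h']
  exact h'.choose_spec

theorem HasWeakDeriv.restrict_of_univ (h : HasWeakDeriv univ u G) (Ω : Set (Euc n)) :
    HasWeakDeriv Ω u G := by
  refine ⟨fun j => (h.locInt j).mono_set (subset_univ _),
    fun i j => (h.locInt_deriv i j).mono_set (subset_univ _), ?_⟩
  intro η hη hc hs i j
  have h0 : ∀ x, x ∉ Ω → x ∉ tsupport η := fun x hx hx' => hx (hs hx')
  have := h.integral_eq η hη hc (subset_univ _) i j
  rw [setIntegral_univ, setIntegral_univ] at this
  rw [setIntegral_eq_integral_of_forall_compl_eq_zero, this,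
    setIntegral_eq_integral_of_forall_compl_eq_zero]
  · intro x hx
    have : fderiv ℝ η x = 0 := by
      by_contra hne
      exact h0 x hx (support_fderiv_subset ℝ hne)
    simp [this]
  · intro x hx
    simp [image_eq_zero_of_notMem_tsupport (h0 x hx)]

theorem HasWeakDeriv.congr_ae (h : HasWeakDeriv univ u G) (huv : ∀ᵐ x, u x = v x) :
    HasWeakDeriv univ v G := by
  refine ⟨fun j => ?_, h.locInt_deriv, fun η hη hc hs i j => ?_⟩
  · have := h.locInt j
    rw [locallyIntegrableOn_univ] at this ⊢
    exact this.congr (by filter_upwards [huv] with x hx using by rw [hx])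
  · rw [h.integral_eq η hη hc hs i j, setIntegral_univ, setIntegral_univ]
    congr 1
    refine integral_congr_ae ?_
    filter_upwards [huv] with x hx
    rw [hx]

/-- The derivative chosen inside `energy` depends on the domain. Uniqueness lets one global
derivative serve for all balls, so that their energies become integrals of a single function. -/
theorem HasWeakDeriv.energy_eq (h : HasWeakDeriv Ω u G) (hΩ : IsOpen Ω) :
    energy Ω u = ∫ x in Ω, ∑ i, ∑ j, G i j x ^ 2 := by
  refine integral_congr_ae ?_
  have : ∀ᵐ x ∂(volume.restrict Ω), ∀ i j, _root_.weakDeriv Ω u i j x = G i j x :=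
    ae_all_iff.2 fun i => ae_all_iff.2 fun j => h.weakDeriv.ae_eq hΩ h i j
  filter_upwards [this] with x hx
  simp only [hx]

end WeakDerivative

/-! ### Determinant and inverse of `1 + s A` -/

section OperatorAlgebra

variable {V : Type*} [NormedAddCommGroup V] [NormedSpace ℝ V]

theorem one_add_zero_smul (A : V →L[ℝ] V) : 1 + (0 : ℝ) • A = 1 := by simp

theorem hasDerivAt_smul_operator (A : V →L[ℝ] V) (s : ℝ) :
    HasDerivAt (fun s : ℝ => s • A) A s := by
  simpa using (hasDerivAt_id s).smul_const A

theorem toLinearMap_one_add_smul (s : ℝ) (A : V →L[ℝ] V) :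
    (1 + s • A : V →L[ℝ] V).toLinearMap = LinearMap.id + s • A.toLinearMap := rfl

theorem det_one_add_smul_eq {ι : Type*} [Fintype ι] [DecidableEq ι] (b : Module.Basis ι ℝ V)
    (s : ℝ) (A : V →L[ℝ] V) :
    (1 + s • A).det = (1 + s • LinearMap.toMatrix b b A.toLinearMap).det := by
  have : (1 : Matrix ι ι ℝ) + s • LinearMap.toMatrix b b A.toLinearMap =
      LinearMap.toMatrix b b (1 + s • A : V →L[ℝ] V).toLinearMap := by
    rw [toLinearMap_one_add_smul, map_add, map_smul, LinearMap.toMatrix_id]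
  rw [this, LinearMap.det_toMatrix]

variable [CompleteSpace V]

theorem differentiableAt_inverse_one_add :
    DifferentiableAt ℝ (fun B : V →L[ℝ] V => Ring.inverse (1 + B)) 0 := by
  have h1 : DifferentiableAt ℝ (Ring.inverse : (V →L[ℝ] V) → _)
      ((fun B : V →L[ℝ] V => 1 + B) 0) := by
    simpa using (hasFDerivAt_ringInverse (𝕜 := ℝ) (1 : (V →L[ℝ] V)ˣ)).differentiableAt
  exact h1.comp 0 (by fun_prop)

theorem hasDerivAt_inverse_one_add_smul' (A : V →L[ℝ] V) :
    HasDerivAt (fun s : ℝ => Ring.inverse (1 + s • A)) (-A) 0 := by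
  have h0 : HasDerivAt (fun s : ℝ => 1 + s • A) A 0 := (hasDerivAt_smul_operator A 0).const_add _
  have h1 : HasFDerivAt (𝕜 := ℝ) Ring.inverse
      (-((ContinuousLinearMap.mulLeftRight ℝ (V →L[ℝ] V))
        ↑(1 : (V →L[ℝ] V)ˣ)⁻¹) ↑(1 : (V →L[ℝ] V)ˣ)⁻¹)
      ((fun s : ℝ => 1 + s • A) 0) := by
    simpa using hasFDerivAt_ringInverse (𝕜 := ℝ) (1 : (V →L[ℝ] V)ˣ)
  simpa [Function.comp_def] using h1.comp_hasDerivAt (0 : ℝ) h0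

end OperatorAlgebra

/-! ### First order expansion of the energy coefficients -/

section FirstOrderExpansion

variable {n : ℕ}

/-- The coefficient `|det (1 + B)| ((1 + B)⁻¹ (1 + B)⁻ᵀ)ₖₗ` of the energy integrand under a
change of variables with derivative `1 + B`. -/
def energyCoeff (B : Euc n →L[ℝ] Euc n) (k l : Fin n) : ℝ :=
  |(1 + B).det| * ∑ i, Ring.inverse (1 + B) (EuclideanSpace.single i 1) k *
    Ring.inverse (1 + B) (EuclideanSpace.single i 1) l

/-- The first order part of `energyCoeff`. -/
def energyCoeffLin (B : Euc n →L[ℝ] Euc n) (k l : Fin n) : ℝ :=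
  (∑ i, B (EuclideanSpace.single i 1) i) * (if k = l then 1 else 0) -
    B (EuclideanSpace.single l 1) k - B (EuclideanSpace.single k 1) l

theorem det_one_eq : (1 : Euc n →L[ℝ] Euc n).det = 1 := LinearMap.det_id

theorem hasDerivAt_det_one_add_smul (A : Euc n →L[ℝ] Euc n) :
    HasDerivAt (fun s : ℝ => (1 + s • A).det) (∑ i, A (EuclideanSpace.single i 1) i) 0 := by
  let b := (EuclideanSpace.basisFun (Fin n) ℝ).toBasis
  let M := LinearMap.toMatrix b b A.toLinearMap
  obtain ⟨q, h⟩ : ∃ q : Polynomial ℝ, (fun s : ℝ => (1 + s • A).det) =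
      fun s : ℝ => 1 + M.trace * s + q.eval s * s ^ 2 :=
    ⟨_, funext fun s => (det_one_add_smul_eq b s A).trans (Matrix.det_one_add_smul s M)⟩
  have ht : M.trace = ∑ i, A (EuclideanSpace.single i 1) i := by
    simp [M, b, Matrix.trace, LinearMap.toMatrix_apply]
  rw [h, ← ht]
  have h1 : HasDerivAt (fun s : ℝ => M.trace * s) M.trace 0 := by
    simpa using (hasDerivAt_id (0 : ℝ)).const_mul M.trace
  have h2 := (q.hasDerivAt 0).mul (hasDerivAt_pow 2 (0 : ℝ))
  exact ((h1.const_add 1).add h2).congr_deriv (by simp)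

theorem hasDerivAt_inverse_one_add_smul (A : Euc n →L[ℝ] Euc n) (v : Euc n) (k : Fin n) :
    HasDerivAt (fun s : ℝ => Ring.inverse (1 + s • A) v k) (-(A v k)) 0 := by
  have h2 := hasDerivAt_inverse_one_add_smul' A
  have h3 := h2.clm_apply (hasDerivAt_const (0 : ℝ) v)
  have h4 := (EuclideanSpace.proj (𝕜 := ℝ) k).hasFDerivAt.comp_hasDerivAt (0 : ℝ) h3
  simpa [Function.comp_def] using h4

theorem energyCoeff_zero (k l : Fin n) :
    energyCoeff (0 : Euc n →L[ℝ] Euc n) k l = if k = l then 1 else 0 := by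
  simp [energyCoeff, det_one_eq, Ring.inverse_one]

theorem hasDerivAt_energyCoeff_smul (A : Euc n →L[ℝ] Euc n) (k l : Fin n) :
    HasDerivAt (fun s : ℝ => energyCoeff (s • A) k l) (energyCoeffLin A k l) 0 := by
  have hd := hasDerivAt_det_one_add_smul A
  have hd' : HasDerivAt (fun s : ℝ => |(1 + s • A).det|)
      (∑ i, A (EuclideanSpace.single i 1) i) 0 := by
    refine hd.congr_of_eventuallyEq ?_
    have : ∀ᶠ s : ℝ in 𝓝 0, 0 < (1 + s • A).det := by
      refine hd.continuousAt.eventually_const_lt ?_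
      simp only
      rw [one_add_zero_smul, det_one_eq]
      exact one_pos
    filter_upwards [this] with s hs
    exact abs_of_pos hs
  have hi := fun i k => hasDerivAt_inverse_one_add_smul A (EuclideanSpace.single i 1) k
  have hsum : HasDerivAt (fun s : ℝ => ∑ i, Ring.inverse (1 + s • A)
      (EuclideanSpace.single i 1) k * Ring.inverse (1 + s • A) (EuclideanSpace.single i 1) l)
      (- A (EuclideanSpace.single l 1) k - A (EuclideanSpace.single k 1) l) 0 := by
    have := HasDerivAt.fun_sum (u := Finset.univ) fun i _ => (hi i k).mul (hi i l)
    refine this.congr_deriv ?_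
    rw [one_add_zero_smul]
    simp [Finset.sum_add_distrib, Ring.inverse_one]
    ring
  refine (hd'.mul hsum).congr_deriv ?_
  rw [one_add_zero_smul]
  simp [energyCoeffLin, det_one_eq, Ring.inverse_one]
  ring

theorem differentiableAt_energyCoeff (k l : Fin n) :
    DifferentiableAt ℝ (fun B : Euc n →L[ℝ] Euc n => energyCoeff B k l) 0 := by
  have hd : DifferentiableAt ℝ (fun B : Euc n →L[ℝ] Euc n => |(1 + B).det|) 0 := by
    have hc : ContDiff ℝ 1 (fun B : Euc n →L[ℝ] Euc n => (1 + B).det) :=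
      ContinuousLinearMap.contDiff_det.comp (contDiff_const.add contDiff_id)
    refine (hc.differentiable (by simp) 0).abs ?_
    simp [det_one_eq]
  have hi : ∀ v m, DifferentiableAt ℝ
      (fun B : Euc n →L[ℝ] Euc n => Ring.inverse (1 + B) v m) 0 := by
    intro v m
    have h2 := (differentiableAt_inverse_one_add (V := Euc n)).clm_apply (differentiableAt_const v)
    exact (EuclideanSpace.proj (𝕜 := ℝ) m).differentiableAt.comp 0 h2
  exact hd.mul (DifferentiableAt.fun_sum fun i _ => (hi _ _).mul (hi _ _))

/-- Fréchet differentiability at `0` makes the error uniform over all directions, hence uniform in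
`x` when `B = s Dζ(x)`. Derivatives along lines serve only to identify the linear part. -/
theorem energyCoeff_expansion {ε : ℝ} (hε : 0 < ε) :
    ∃ δ > 0, ∀ B : Euc n →L[ℝ] Euc n, ‖B‖ < δ → ∀ k l,
      |energyCoeff B k l - (if k = l then 1 else 0) - energyCoeffLin B k l| ≤ ε * ‖B‖ := by
  have key : ∀ k l, ∀ᶠ B : Euc n →L[ℝ] Euc n in 𝓝 0,
      |energyCoeff B k l - (if k = l then 1 else 0) - energyCoeffLin B k l| ≤ ε * ‖B‖ := by
    intro k l
    have h := (differentiableAt_energyCoeff (n := n) k l).hasFDerivAt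
    have hL : ∀ A, fderiv ℝ (fun B : Euc n →L[ℝ] Euc n => energyCoeff B k l) 0 A =
        energyCoeffLin A k l := by
      intro A
      have h' : HasFDerivAt (fun B : Euc n →L[ℝ] Euc n => energyCoeff B k l)
          (fderiv ℝ (fun B : Euc n →L[ℝ] Euc n => energyCoeff B k l) 0)
          ((0 : ℝ) • A) := by
        rw [zero_smul ℝ A]
        exact h
      have h'' : HasDerivAt (fun s : ℝ => energyCoeff (s • A) k l) _ 0 :=
        HasFDerivAt.comp_hasDerivAt (f := fun s : ℝ => s • A) (0 : ℝ) h'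
          (hasDerivAt_smul_operator A 0)
      exact h''.unique (hasDerivAt_energyCoeff_smul A k l)
    have := (hasFDerivAt_iff_isLittleO_nhds_zero.1 h).def hε
    filter_upwards [this] with B hB
    simpa [hL, energyCoeff_zero] using hB
  have key' : ∀ᶠ B : Euc n →L[ℝ] Euc n in 𝓝 0, ∀ k l,
      |energyCoeff B k l - (if k = l then 1 else 0) - energyCoeffLin B k l| ≤ ε * ‖B‖ :=
    eventually_all.2 fun k => eventually_all.2 fun l => key k l
  obtain ⟨δ, hδ, h⟩ := Metric.eventually_nhds_iff.1 key'
  exact ⟨δ, hδ, fun B hB => h (by simpa using hB)⟩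

theorem energyCoeffLin_smul (s : ℝ) (A : Euc n →L[ℝ] Euc n) (k l : Fin n) :
    energyCoeffLin (s • A) k l = s * energyCoeffLin A k l := by
  simp only [energyCoeffLin, _root_.smul_apply, PiLp.smul_apply, smul_eq_mul,
    ← Finset.mul_sum]
  ring

end FirstOrderExpansion

/-! ### Diffeomorphisms close to the identity -/

section Perturbation

variable {n : ℕ}

theorem exists_norm_fderiv_le {ζ : Euc n → Euc n} (hζ : ContDiff ℝ ∞ ζ)
    (hc : HasCompactSupport ζ) : ∃ C > 0, ∀ x, ‖fderiv ℝ ζ x‖ ≤ C := by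
  obtain ⟨C, hC⟩ := (hζ.continuous_fderiv (by simp)).bounded_above_of_compact_support
    (hc.fderiv (𝕜 := ℝ))
  exact ⟨max C 1, by positivity, fun x => (hC x).trans (le_max_left _ _)⟩

/-- A perturbation of the identity with Lipschitz constant below one is a homeomorphism. Its
derivative is invertible by the Neumann series, so the inverse is smooth. -/
theorem exists_smoothInverse_add_smul {ζ : Euc n → Euc n} (hζ : ContDiff ℝ ∞ ζ) {C s : ℝ}
    (hC : ∀ x, ‖fderiv ℝ ζ x‖ ≤ C) (hs : |s| * C < 1) :
    ∃ g, SmoothInverse (fun x => x + s • ζ x) g := by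
  have hC0 : 0 ≤ C := (norm_nonneg _).trans (hC 0)
  set f : Euc n → Euc n := fun x => x + s • ζ x with hf
  have hfs : ContDiff ℝ ∞ f := contDiff_id.add (hζ.const_smul s)
  let c : NNReal := ⟨|s| * C, by positivity⟩
  have hζd : ∀ x, HasFDerivAt ζ (fderiv ℝ ζ x) x := fun x =>
    (hζ.differentiable (by simp) x).hasFDerivAt
  have hfd : ∀ x, HasFDerivAt f (1 + s • fderiv ℝ ζ x) x := fun x =>
    (hasFDerivAt_id x).add ((hζd x).const_smul s)
  have hlip : LipschitzWith c (fun x => s • ζ x) := by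
    refine lipschitzWith_of_nnnorm_fderiv_le (𝕜 := ℝ)
      ((hζ.differentiable (by simp)).const_smul s) fun x => ?_
    have e : fderiv ℝ (fun x => s • ζ x) x = s • fderiv ℝ ζ x := ((hζd x).const_smul s).fderiv
    rw [e, ← NNReal.coe_le_coe]
    simp only [coe_nnnorm, norm_smul, Real.norm_eq_abs]
    exact mul_le_mul_of_nonneg_left (hC x) (abs_nonneg s)
  have happ : ApproximatesLinearOn f
      ((ContinuousLinearEquiv.refl ℝ (Euc n) : Euc n ≃L[ℝ] Euc n) : Euc n →L[ℝ] Euc n)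
      univ c := by
    intro x _ y _
    have := hlip.dist_le_mul x y
    rw [dist_eq_norm, dist_eq_norm] at this
    have e : f x - f y - (x - y) = s • ζ x - s • ζ y := by
      simp only [hf]
      abel
    rw [← e] at this
    exact this
  have hcl : Subsingleton (Euc n) ∨
      c < ‖((ContinuousLinearEquiv.refl ℝ (Euc n)).symm : Euc n →L[ℝ] Euc n)‖₊⁻¹ := by
    rcases subsingleton_or_nontrivial (Euc n) with h | h
    · exact Or.inl h
    · right
      have e : ((ContinuousLinearEquiv.refl ℝ (Euc n)).symm : Euc n →L[ℝ] Euc n) =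
        ContinuousLinearMap.id ℝ _ := rfl
      rw [e]
      have : ‖ContinuousLinearMap.id ℝ (Euc n)‖₊ = 1 := by
        ext; simp
      rw [this, inv_one, ← NNReal.coe_lt_coe]
      exact hs
  let F := happ.toHomeomorph f hcl
  have hF : ∀ x, F x = f x := fun x => rfl
  have hunit : ∀ x, IsUnit (1 + s • fderiv ℝ ζ x) := by
    intro x
    have : ‖-(s • fderiv ℝ ζ x)‖ < 1 := by
      rw [norm_neg, norm_smul, Real.norm_eq_abs]
      exact (mul_le_mul_of_nonneg_left (hC x) (abs_nonneg s)).trans_lt hs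
    have h := isUnit_one_sub_of_norm_lt_one this
    rwa [sub_neg_eq_add] at h
  refine ⟨F.symm, hfs, ?_, fun x => F.symm_apply_apply x, fun x => F.apply_symm_apply x⟩
  refine F.contDiff_symm (f₀' := fun x =>
    ContinuousLinearEquiv.unitsEquiv ℝ (Euc n) (hunit x).unit) (fun x => ?_) hfs
  exact hfd x

end Perturbation


/-- `G` is the weak derivative of the map `u` on `ℝⁿ`, and both are locally square integrable. -/
structure HasLocL2Deriv {n p : ℕ} (u : Euc n → Euc p) (G : Fin n → Fin p → Euc n → ℝ) :
    Prop where
  hasWeakDeriv : HasWeakDeriv univ u G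
  memLp : ∀ K, IsCompact K → MemLp u 2 (volume.restrict K)
  memLp_deriv : ∀ K, IsCompact K → ∀ i j, MemLp (G i j) 2 (volume.restrict K)

theorem MemW12Loc.hasLocL2Deriv {n p : ℕ} {N : Set (Euc p)} {u : Euc n → Euc p}
    (h : MemW12Loc univ N u) : HasLocL2Deriv u (weakDeriv univ u) := by
  obtain ⟨⟨G, hG, hL⟩, -⟩ := h
  refine ⟨hG.weakDeriv, fun K hK => (hL K (subset_univ _) hK).1, fun K hK i j => ?_⟩
  refine (memLp_congr_ae ?_).1 ((hL K (subset_univ _) hK).2 i j)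
  have := hG.ae_eq isOpen_univ hG.weakDeriv i j
  rw [Measure.restrict_univ] at this
  exact ae_restrict_of_ae this

/-! ### Energy and admissibility of the deformed map -/

section Competitor

variable {n p : ℕ} {f g : Euc n → Euc n} {u : Euc n → Euc p} {G : Fin n → Fin p → Euc n → ℝ}

theorem HasLocL2Deriv.locallyIntegrable_mul (h : HasLocL2Deriv u G) (k l : Fin n) (j : Fin p) :
    LocallyIntegrable fun x => G k j x * G l j x := by
  rw [locallyIntegrable_iff]
  exact fun K hK => (h.memLp_deriv K hK k j).integrable_mul (h.memLp_deriv K hK l j)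

theorem HasLocL2Deriv.locallyIntegrable_energyDensity (h : HasLocL2Deriv u G) :
    LocallyIntegrable fun x => ∑ i, ∑ j, G i j x ^ 2 := by
  refine locallyIntegrable_finsetSum _ fun i _ => locallyIntegrable_finsetSum _ fun j _ => ?_
  simpa only [sq] using h.locallyIntegrable_mul i i j

theorem SmoothInverse.inverse_fderiv (h : SmoothInverse f g) (x : Euc n) :
    Ring.inverse (fderiv ℝ f x) = fderiv ℝ g (f x) := by
  have h1 : fderiv ℝ g (f x) * fderiv ℝ f x = 1 := h.fderiv_comp_fderiv x
  have h2 : fderiv ℝ f x * fderiv ℝ g (f x) = 1 := by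
    have := h.symm.fderiv_comp_fderiv (f x)
    rwa [h.left_inv x] at this
  exact Ring.inverse_unit ⟨fderiv ℝ f x, fderiv ℝ g (f x), h2, h1⟩

/-- The Gram form of the deformed energy integrand: it yields the coefficients in `energy_comp`, and
later the nonnegativity of the integrand. -/
theorem sum_mul_gram_eq (a : Fin n → ℝ) (c : Fin n → Fin n → ℝ) (d : ℝ) :
    ∑ k, ∑ l, a k * a l * (d * ∑ i, c i k * c i l) = d * ∑ i, (∑ k, a k * c i k) ^ 2 := by
  have h : ∀ i, (∑ k, a k * c i k) ^ 2 = ∑ k, ∑ l, a k * c i k * (a l * c i l) := fun i => by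
    rw [sq, Finset.sum_mul_sum]
  simp only [h, Finset.mul_sum]
  conv_rhs => rw [Finset.sum_comm]
  refine Finset.sum_congr rfl fun k _ => ?_
  conv_rhs => rw [Finset.sum_comm]
  refine Finset.sum_congr rfl fun l _ => Finset.sum_congr rfl fun i _ => ?_
  ring

/-- After substituting `f x`, the gradient of `u` is evaluated at `x` itself and only smooth
coefficients depend on the deformation, so no further regularity of `u` is needed to expand in `s`.
-/
theorem SmoothInverse.energy_comp (h : SmoothInverse f g) (hu : HasLocL2Deriv u G)
    {B : Set (Euc n)} (hB : IsOpen B) (hfB : f '' B = B) {A : Euc n → Euc n →L[ℝ] Euc n}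
    (hA : ∀ x, fderiv ℝ f x = 1 + A x) :
    energy B (fun x => u (g x)) =
      ∫ x in B, ∑ j, ∑ k, ∑ l, G k j x * G l j x * energyCoeff (A x) k l := by
  rw [((h.symm.hasWeakDeriv_comp hu.hasWeakDeriv).restrict_of_univ B).energy_eq hB]
  conv_lhs => rw [← hfB]
  rw [h.setIntegral_comp hB.measurableSet]
  congr 1 with x
  simp only [energyCoeff, ← hA x, h.inverse_fderiv x, h.left_inv x]
  rw [Finset.sum_comm, Finset.mul_sum]
  exact Finset.sum_congr rfl fun j _ => (sum_mul_gram_eq _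
    (fun i k => fderiv ℝ g (f x) (EuclideanSpace.single i 1) k) _).symm

theorem SmoothInverse.memW12_comp (h : SmoothInverse f g) (hu : HasLocL2Deriv u G)
    {N : Set (Euc p)} (hN : ∀ᵐ x, u x ∈ N) {B K : Set (Euc n)} (hBK : B ⊆ K)
    (hK : IsCompact K) : MemW12 B N (fun x => u (g x)) := by
  have hgK : IsCompact (g '' K) := hK.image h.smooth_inv.continuous
  refine ⟨⟨_, (h.symm.hasWeakDeriv_comp hu.hasWeakDeriv).restrict_of_univ B, ?_, ?_⟩, ?_⟩
  · exact (h.symm.memLp_comp hK (hu.memLp _ hgK)).mono_measure (Measure.restrict_mono_set _ hBK)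
  · intro i j
    refine MemLp.mono_measure (Measure.restrict_mono_set _ hBK) ?_
    refine memLp_finsetSum _ fun k _ => ?_
    have hD : Continuous fun x => fderiv ℝ g x (EuclideanSpace.single i 1) k :=
      ((contDiff_euclidean.1 (h.symm.contDiff_fderiv.clm_apply contDiff_const)) k).continuous
    obtain ⟨C, hC⟩ := hK.exists_bound_of_continuousOn hD.continuousOn
    have hG := h.symm.memLp_comp hK (hu.memLp_deriv _ hgK k j)
    refine hG.of_le_mul (c := C) (hG.aestronglyMeasurable.mul
      hD.aestronglyMeasurable) ?_
    filter_upwards [ae_restrict_mem hK.measurableSet] with x hx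
    rw [norm_mul, mul_comm]
    exact mul_le_mul_of_nonneg_right (hC x hx) (norm_nonneg _)
  · exact ae_restrict_of_ae (h.symm.quasiMeasurePreserving.ae hN)

end Competitor

/-! ### Stationarity under domain deformations -/

section Stationarity

variable {n p : ℕ} {u : Euc n → Euc p} {G : Fin n → Fin p → Euc n → ℝ}

/-- The map fixes every point off `B`, so a bijection cannot move points across the boundary of `B`
in either direction. -/
theorem image_add_smul_eq {ζ : Euc n → Euc n} {s : ℝ} {g : Euc n → Euc n}
    (h : SmoothInverse (fun x => x + s • ζ x) g) {B : Set (Euc n)} (hB : tsupport ζ ⊆ B) :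
    (fun x => x + s • ζ x) '' B = B := by
  have h0 : ∀ x, x ∉ B → x + s • ζ x = x := fun x hx => by
    rw [image_eq_zero_of_notMem_tsupport fun hx' => hx (hB hx')]
    simp
  apply Subset.antisymm
  · rintro _ ⟨x, hx, rfl⟩
    by_contra hne
    have := h.left_inv.injective (h0 _ hne)
    exact hne (by simpa only [this] using hx)
  · intro x hx
    refine ⟨g x, ?_, h.right_inv x⟩
    by_contra hne
    have h1 := h0 _ hne
    have h2 := h.right_inv x
    rw [h1] at h2
    exact hne (by rwa [h2])

theorem sum_quadratic_le (a : Fin n → ℝ) {M : Fin n → Fin n → ℝ} {ε : ℝ}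
    (hM : ∀ k l, |M k l| ≤ ε) :
    ∑ k, ∑ l, a k * a l * M k l ≤ ε * n * ∑ k, a k ^ 2 := by
  calc ∑ k, ∑ l, a k * a l * M k l ≤ ∑ k, ∑ l, ε * ((a k ^ 2 + a l ^ 2) / 2) := by
        refine Finset.sum_le_sum fun k _ => Finset.sum_le_sum fun l _ => ?_
        have hε : 0 ≤ ε := (abs_nonneg _).trans (hM k l)
        calc a k * a l * M k l ≤ |a k * a l| * |M k l| := by
              rw [← abs_mul]; exact le_abs_self _
          _ ≤ ((a k ^ 2 + a l ^ 2) / 2) * ε := by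
              refine mul_le_mul ?_ (hM k l) (abs_nonneg _) (by positivity)
              rw [abs_le]
              constructor <;> nlinarith [sq_nonneg (a k + a l), sq_nonneg (a k - a l)]
          _ = _ := mul_comm _ _
    _ = ε * n * ∑ k, a k ^ 2 := by
        simp only [← Finset.mul_sum, ← Finset.sum_div, Finset.sum_add_distrib, Finset.sum_const,
          Finset.card_univ, Fintype.card_fin, nsmul_eq_mul]
        ring

theorem continuous_energyCoeffLin (k l : Fin n) :
    Continuous fun A : Euc n →L[ℝ] Euc n => energyCoeffLin A k l := by
  have h : ∀ v m, Continuous fun A : Euc n →L[ℝ] Euc n => A v m := fun v m =>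
    (EuclideanSpace.proj (𝕜 := ℝ) m).continuous.comp
      ((ContinuousLinearMap.apply ℝ (Euc n) v).continuous)
  have h1 : Continuous fun A : Euc n →L[ℝ] Euc n =>
      (∑ i, A (EuclideanSpace.single i 1) i) * (if k = l then (1 : ℝ) else 0) :=
    (continuous_finsetSum _ fun i _ => h (EuclideanSpace.single i 1) i).mul continuous_const
  exact (h1.sub (h (EuclideanSpace.single l 1) k)).sub (h (EuclideanSpace.single k 1) l)

/-- The first variation formula with respect to variations of the domain. -/
theorem IsEnergyMinimizing.integral_energyCoeffLin_eq_zero {N : Set (Euc p)}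
    (hmin : IsEnergyMinimizing univ N u) (hu : HasLocL2Deriv u G) {ζ : Euc n → Euc n}
    (hζ : ContDiff ℝ ∞ ζ) (hc : HasCompactSupport ζ) :
    ∫ x, ∑ j, ∑ k, ∑ l, G k j x * G l j x * energyCoeffLin (fderiv ℝ ζ x) k l = 0 := by
  obtain ⟨r, hr⟩ := hc.isCompact.isBounded.subset_ball (0 : Euc n)
  set ρ := max r 1 with hρ
  have hρ0 : 0 < ρ := by positivity
  set B := ball (0 : Euc n) ρ with hB
  have hsB : tsupport ζ ⊆ B := hr.trans (ball_subset_ball (le_max_left _ _))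
  have hBo : IsOpen B := isOpen_ball
  have hBK : B ⊆ closedBall (0 : Euc n) ρ := ball_subset_closedBall
  have hK : IsCompact (closedBall (0 : Euc n) ρ) := isCompact_closedBall _ _
  obtain ⟨C, hC0, hC⟩ := exists_norm_fderiv_le hζ hc
  have hNae : ∀ᵐ x, u x ∈ N := by simpa using hmin.1.2
  have hE : IntegrableOn (fun x => ∑ i, ∑ j, G i j x ^ 2) B :=
    (hu.locallyIntegrable_energyDensity.integrableOn_isCompact hK).mono_set hBK
  have hLint : IntegrableOn (fun x => ∑ j, ∑ k, ∑ l,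
      G k j x * G l j x * energyCoeffLin (fderiv ℝ ζ x) k l) B := by
    refine integrable_finsetSum _ fun j _ => integrable_finsetSum _ fun k _ =>
      integrable_finsetSum _ fun l _ => ?_
    have h1 : IntegrableOn (fun x => G k j x * G l j x) (closedBall (0 : Euc n) ρ) :=
      (hu.locallyIntegrable_mul k l j).integrableOn_isCompact hK
    exact (h1.mul_continuousOn ((continuous_energyCoeffLin k l).comp
      (hζ.continuous_fderiv (by simp))).continuousOn hK).mono_set hBK
  have hres : ∫ x, ∑ j, ∑ k, ∑ l, G k j x * G l j x * energyCoeffLin (fderiv ℝ ζ x) k l =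
      ∫ x in B, ∑ j, ∑ k, ∑ l, G k j x * G l j x * energyCoeffLin (fderiv ℝ ζ x) k l := by
    refine (setIntegral_eq_integral_of_forall_compl_eq_zero fun x hx => ?_).symm
    have : fderiv ℝ ζ x = 0 := by
      by_contra hne
      exact hx (hsB (support_fderiv_subset ℝ hne))
    simp [this, energyCoeffLin]
  rw [hres]
  set E := ∫ x in B, ∑ i, ∑ j, G i j x ^ 2
  set L := ∫ x in B, ∑ j, ∑ k, ∑ l, G k j x * G l j x * energyCoeffLin (fderiv ℝ ζ x) k l
  have hE0 : 0 ≤ E := integral_nonneg fun x => by positivity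
  have key : ∀ ε > 0, ∃ δ > 0, ∀ s : ℝ, |s| < δ → -(s * L) ≤ ε * |s| * (C * n * E) := by
    intro ε hε
    obtain ⟨δ, hδ, hexp⟩ := energyCoeff_expansion (n := n) hε
    -- The first bound brings `s Dζ` into the range of the expansion; the second makes `x + s ζ(x)`
    -- a diffeomorphism.
    refine ⟨min (δ / C) (1 / C), by positivity, fun s hs => ?_⟩
    have hs1 : |s| * C < δ := by
      rw [← lt_div_iff₀ hC0]; exact hs.trans_le (min_le_left _ _)
    have hs2 : |s| * C < 1 := by
      rw [← lt_div_iff₀ hC0]; exact hs.trans_le (min_le_right _ _)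
    obtain ⟨g, hg⟩ := exists_smoothInverse_add_smul hζ hC hs2
    have hfd : ∀ x, fderiv ℝ (fun x => x + s • ζ x) x = 1 + s • fderiv ℝ ζ x := fun x =>
      ((hasFDerivAt_id x).add
        (((hζ.differentiable (by simp) x).hasFDerivAt).const_smul s)).fderiv
    have hle : energy B u ≤ energy B (fun x => u (g x)) := by
      refine hmin.2 0 ρ hρ0 (subset_univ _) _ (hg.memW12_comp hu hNae hBK hK)
        ⟨(tsupport ζ)ᶜ, (isClosed_tsupport ζ).isOpen_compl, ?_, ?_⟩
      · intro x hx hx'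
        have h1 := hsB hx'
        rw [hB, mem_ball] at h1
        rw [mem_sphere] at hx
        exact h1.ne hx
      · filter_upwards [ae_restrict_mem
          (hBo.inter (isClosed_tsupport ζ).isOpen_compl).measurableSet] with x hx
        have h1 : x + s • ζ x = x := by
          rw [image_eq_zero_of_notMem_tsupport hx.2]
          simp
        have h2 := hg.left_inv x
        simp only [h1] at h2
        rw [h2]
    rw [hg.energy_comp hu hBo (image_add_smul_eq hg hsB) hfd,
      (hu.hasWeakDeriv.restrict_of_univ B).energy_eq hBo] at hle
    have hup : ∫ x in B, ∑ j, ∑ k, ∑ l, G k j x * G l j x * energyCoeff (s • fderiv ℝ ζ x) k l ≤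
        ∫ x in B, ((∑ i, ∑ j, G i j x ^ 2) + s * (∑ j, ∑ k, ∑ l,
          G k j x * G l j x * energyCoeffLin (fderiv ℝ ζ x) k l) +
            ε * |s| * C * n * ∑ i, ∑ j, G i j x ^ 2) := by
      -- Nonnegativity of the deformed integrand replaces a proof of its integrability.
      refine integral_mono_of_nonneg (ae_of_all _ fun x => ?_)
        ((hE.add (hLint.const_mul s)).add (hE.const_mul _)) (ae_of_all _ fun x => ?_)
      · simp only [Pi.zero_apply]
        refine Finset.sum_nonneg fun j _ => ?_
        have := sum_mul_gram_eq (fun k => G k j x) (fun i k =>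
          Ring.inverse (1 + s • fderiv ℝ ζ x) (EuclideanSpace.single i 1) k)
          |(1 + s • fderiv ℝ ζ x).det|
        simp only [energyCoeff]
        rw [this]
        positivity
      · simp only
        have hn : ‖s • fderiv ℝ ζ x‖ ≤ |s| * C := by
          rw [norm_smul, Real.norm_eq_abs]
          exact mul_le_mul_of_nonneg_left (hC x) (abs_nonneg s)
        have hb : ∀ k l, |energyCoeff (s • fderiv ℝ ζ x) k l - (if k = l then 1 else 0) -
            s * energyCoeffLin (fderiv ℝ ζ x) k l| ≤ ε * (|s| * C) := fun k l => by
          rw [← energyCoeffLin_smul]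
          exact (hexp _ (hn.trans_lt hs1) k l).trans (mul_le_mul_of_nonneg_left hn hε.le)
        rw [Finset.sum_comm (f := fun i j => G i j x ^ 2), Finset.mul_sum, Finset.mul_sum,
          ← Finset.sum_add_distrib, ← Finset.sum_add_distrib]
        refine Finset.sum_le_sum fun j _ => ?_
        have h1 := sum_quadratic_le (fun k => G k j x) hb
        have h2 : ∑ k, ∑ l, G k j x * G l j x * energyCoeff (s • fderiv ℝ ζ x) k l =
            ∑ k, G k j x ^ 2 +
            s * ∑ k, ∑ l, G k j x * G l j x * energyCoeffLin (fderiv ℝ ζ x) k l +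
            ∑ k, ∑ l, G k j x * G l j x * (energyCoeff (s • fderiv ℝ ζ x) k l -
              (if k = l then 1 else 0) - s * energyCoeffLin (fderiv ℝ ζ x) k l) := by
          rw [Finset.mul_sum, ← Finset.sum_add_distrib, ← Finset.sum_add_distrib]
          refine Finset.sum_congr rfl fun k _ => ?_
          have : G k j x ^ 2 = ∑ l, G k j x * G l j x * (if k = l then 1 else 0) := by
            simp [sq]
          rw [this, Finset.mul_sum, ← Finset.sum_add_distrib, ← Finset.sum_add_distrib]
          refine Finset.sum_congr rfl fun l _ => ?_
          ring
        rw [h2]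
        linarith
    have hsplit : ∫ x in B, ((∑ i, ∑ j, G i j x ^ 2) + s * (∑ j, ∑ k, ∑ l,
          G k j x * G l j x * energyCoeffLin (fderiv ℝ ζ x) k l) +
            ε * |s| * C * n * ∑ i, ∑ j, G i j x ^ 2) = E + s * L + ε * |s| * C * n * E := by
      have e1 := integral_add (hE.add (hLint.const_mul s)) (hE.const_mul (ε * |s| * C * n))
      have e2 := integral_add hE (hLint.const_mul s)
      simp only [Pi.add_apply] at e1
      rw [e1, e2, integral_const_mul, integral_const_mul]
    rw [hsplit] at hup
    have : E ≤ E + s * L + ε * |s| * C * n * E := hle.trans hup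
    linarith
  by_contra hL
  have hLpos : 0 < |L| := abs_pos.2 hL
  have hD : 0 ≤ C * n * E := by positivity
  -- With this `ε` the error is at most `|s| |L| / 2`, which is impossible for `s` of sign opposite
  -- to `L`. The `+ 1` covers the case of zero energy.
  obtain ⟨δ, hδ, hk⟩ := key (|L| / (2 * (C * n * E + 1))) (by positivity)
  have hb : |L| / (2 * (C * n * E + 1)) * (C * n * E) ≤ |L| / 2 := by
    rw [div_mul_eq_mul_div, div_le_div_iff₀ (by positivity) (by positivity)]
    nlinarith
  rcases lt_or_gt_of_ne hL with h | h
  · have := hk (δ / 2) (by rw [abs_of_pos (by positivity)]; linarith)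
    rw [abs_of_pos (by positivity : 0 < δ / 2)] at this
    rw [abs_of_neg h] at this hb
    nlinarith
  · have := hk (-(δ / 2)) (by rw [abs_neg, abs_of_pos (by positivity)]; linarith)
    rw [abs_neg, abs_of_pos (by positivity : 0 < δ / 2)] at this
    rw [abs_of_pos h] at this hb
    nlinarith

end Stationarity


/-! ### Stationarity for radial fields -/

section RadialVariation

variable {n p : ℕ} {u : Euc n → Euc p} {G : Fin n → Fin p → Euc n → ℝ}

/-- The profile is a function of the squared distance, which keeps the field smooth at `y`. -/
theorem hasFDerivAt_radialField {η : ℝ → ℝ} (hη : ContDiff ℝ ∞ η) (y x : Euc n) :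
    HasFDerivAt (fun x => η (‖x - y‖ ^ 2) • (x - y))
      (η (‖x - y‖ ^ 2) • ContinuousLinearMap.id ℝ (Euc n) +
        (deriv η (‖x - y‖ ^ 2) • (2 • innerSL ℝ (x - y))).smulRight (x - y)) x := by
  have h1 : HasFDerivAt (fun x => x - y) (ContinuousLinearMap.id ℝ (Euc n)) x :=
    (hasFDerivAt_id x).sub_const y
  have h2 : HasFDerivAt (fun x => ‖x - y‖ ^ 2) (2 • innerSL ℝ (x - y)) x := by
    have := h1.norm_sq
    simpa using this
  have h3 : HasDerivAt η (deriv η (‖x - y‖ ^ 2)) (‖x - y‖ ^ 2) :=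
    (hη.differentiable (by simp) _).hasDerivAt
  exact (h3.comp_hasFDerivAt x h2).smul h1

theorem fderiv_radialField_apply {η : ℝ → ℝ} (hη : ContDiff ℝ ∞ η) (y x : Euc n) (k l : Fin n) :
    fderiv ℝ (fun x => η (‖x - y‖ ^ 2) • (x - y)) x (EuclideanSpace.single l 1) k =
      η (‖x - y‖ ^ 2) * (if k = l then 1 else 0) +
        2 * deriv η (‖x - y‖ ^ 2) * ((x - y) l * (x - y) k) := by
  rw [(hasFDerivAt_radialField hη y x).fderiv]
  have e : inner ℝ (x - y) (EuclideanSpace.single l (1 : ℝ)) = (x - y) l := by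
    rw [EuclideanSpace.inner_single_right]; simp
  simp only [_root_.add_apply, _root_.smul_apply, ContinuousLinearMap.id_apply,
    ContinuousLinearMap.smulRight_apply, innerSL_apply_apply, PiLp.add_apply, PiLp.smul_apply,
    smul_eq_mul, nsmul_eq_mul, Nat.cast_ofNat, e]
  simp only [EuclideanSpace.single, PiLp.single_apply]
  ring

/-- The derivative `η I + 2 η' (x - y) ⊗ (x - y)` is symmetric with trace `n η + 2 r² η'`;
subtracting it twice from its trace times the identity leaves the two terms on the right. -/
theorem sum_mul_energyCoeffLin_radialField {η : ℝ → ℝ} (hη : ContDiff ℝ ∞ η) (y x : Euc n) :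
    ∑ j, ∑ k, ∑ l, G k j x * G l j x *
        energyCoeffLin (fderiv ℝ (fun x => η (‖x - y‖ ^ 2) • (x - y)) x) k l =
      ((n - 2) * η (‖x - y‖ ^ 2) + 2 * ‖x - y‖ ^ 2 * deriv η (‖x - y‖ ^ 2)) *
        ∑ i, ∑ j, G i j x ^ 2 -
      4 * deriv η (‖x - y‖ ^ 2) * ∑ j, (∑ i, (x i - y i) * G i j x) ^ 2 := by
  have hr : ∑ i, (x - y) i * (x - y) i = ‖x - y‖ ^ 2 := by
    rw [EuclideanSpace.real_norm_sq_eq]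
    simp only [sq]
  have hlin : ∀ k l, energyCoeffLin (fderiv ℝ (fun x => η (‖x - y‖ ^ 2) • (x - y)) x) k l =
      ((n - 2) * η (‖x - y‖ ^ 2) + 2 * ‖x - y‖ ^ 2 * deriv η (‖x - y‖ ^ 2)) *
        (if k = l then 1 else 0) - 4 * deriv η (‖x - y‖ ^ 2) * ((x - y) k * (x - y) l) := by
    intro k l
    simp only [energyCoeffLin, fderiv_radialField_apply hη, Finset.sum_add_distrib,
      ← Finset.mul_sum, hr]
    simp only [if_true, Finset.sum_const, Finset.card_univ, Fintype.card_fin, nsmul_eq_mul,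
      mul_one, eq_comm (a := l) (b := k)]
    ring
  rw [Finset.sum_comm (f := fun i j => G i j x ^ 2), Finset.mul_sum, Finset.mul_sum,
    ← Finset.sum_sub_distrib]
  refine Finset.sum_congr rfl fun j _ => ?_
  rw [sq (∑ i, (x i - y i) * G i j x), Finset.sum_mul_sum, Finset.mul_sum, Finset.mul_sum,
    ← Finset.sum_sub_distrib]
  refine Finset.sum_congr rfl fun k _ => ?_
  have : G k j x ^ 2 = ∑ l, G k j x * G l j x * (if k = l then 1 else 0) := by simp [sq]
  rw [this, Finset.mul_sum, Finset.mul_sum, ← Finset.sum_sub_distrib]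
  refine Finset.sum_congr rfl fun l _ => ?_
  rw [hlin, PiLp.sub_apply, PiLp.sub_apply]
  ring

/-- The first variation formula for radial vector fields. -/
theorem IsEnergyMinimizing.integral_radial_eq_zero {N : Set (Euc p)}
    (hmin : IsEnergyMinimizing univ N u) (hu : HasLocL2Deriv u G) {η : ℝ → ℝ}
    (hη : ContDiff ℝ ∞ η) {b : ℝ} (hb : ∀ t, b ≤ t → η t = 0) (y : Euc n) :
    ∫ x, (((n - 2) / 2 * η (‖x - y‖ ^ 2) + ‖x - y‖ ^ 2 * deriv η (‖x - y‖ ^ 2)) *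
        ∑ i, ∑ j, G i j x ^ 2 -
      2 * deriv η (‖x - y‖ ^ 2) * ∑ j, (∑ i, (x i - y i) * G i j x) ^ 2) = 0 := by
  have hζ : ContDiff ℝ ∞ fun x : Euc n => η (‖x - y‖ ^ 2) • (x - y) := by
    have h1 : ContDiff ℝ ∞ fun x : Euc n => x - y := contDiff_id.sub contDiff_const
    exact (hη.comp (h1.norm_sq ℝ)).smul h1
  have hc : HasCompactSupport fun x : Euc n => η (‖x - y‖ ^ 2) • (x - y) := by
    refine HasCompactSupport.intro (isCompact_closedBall y (Real.sqrt b)) fun x hx => ?_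
    rw [mem_closedBall, dist_eq_norm, not_le] at hx
    rw [hb _ (Real.lt_sq_of_sqrt_lt hx).le, zero_smul]
  have h := hmin.integral_energyCoeffLin_eq_zero hu hζ hc
  simp only [sum_mul_energyCoeffLin_radialField hη] at h
  have h2 := integral_const_mul (μ := (volume : Measure (Euc n))) (1 / 2 : ℝ) (fun x =>
    ((n - 2) * η (‖x - y‖ ^ 2) + 2 * ‖x - y‖ ^ 2 * deriv η (‖x - y‖ ^ 2)) *
        (∑ i, ∑ j, G i j x ^ 2) -
      4 * deriv η (‖x - y‖ ^ 2) * ∑ j, (∑ i, (x i - y i) * G i j x) ^ 2)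
  rw [h, mul_zero] at h2
  rw [← h2]
  congr 1 with x
  ring

/-- Cauchy–Schwarz in each component; it dominates the radial term by the energy density. -/
theorem sum_sq_radial_le (y x : Euc n) :
    ∑ j, (∑ i, (x i - y i) * G i j x) ^ 2 ≤ ‖x - y‖ ^ 2 * ∑ i, ∑ j, G i j x ^ 2 := by
  rw [Finset.sum_comm, Finset.mul_sum]
  refine Finset.sum_le_sum fun j _ => ?_
  rw [EuclideanSpace.real_norm_sq_eq]
  simpa using Finset.sum_mul_sq_le_sq_mul_sq Finset.univ (fun i => x i - y i) (fun i => G i j x)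

end RadialVariation

/-! ### Smooth approximations of the truncated power profile -/

section Cutoff

/-- A smooth function that is `0` off `(a, b)`; as `k → ∞` it tends to the indicator function. -/
def smoothBump (a b : ℝ) (k : ℕ) (t : ℝ) : ℝ :=
  Real.smoothTransition (k * (t - a)) * Real.smoothTransition (k * (b - t))

variable {a b : ℝ}

theorem contDiff_smoothBump (k : ℕ) : ContDiff ℝ ∞ (smoothBump a b k) := by
  unfold smoothBump
  exact (Real.smoothTransition.contDiff.comp (by fun_prop)).mul
    (Real.smoothTransition.contDiff.comp (by fun_prop))

theorem smoothBump_nonneg (k : ℕ) (t : ℝ) : 0 ≤ smoothBump a b k t :=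
  mul_nonneg (Real.smoothTransition.nonneg _) (Real.smoothTransition.nonneg _)

theorem smoothBump_le_one (k : ℕ) (t : ℝ) : smoothBump a b k t ≤ 1 :=
  mul_le_one₀ (Real.smoothTransition.le_one _) (Real.smoothTransition.nonneg _)
    (Real.smoothTransition.le_one _)

theorem smoothBump_of_le {t : ℝ} (h : t ≤ a) (k : ℕ) : smoothBump a b k t = 0 := by
  rw [smoothBump, Real.smoothTransition.zero_of_nonpos, zero_mul]
  exact mul_nonpos_of_nonneg_of_nonpos k.cast_nonneg (by linarith)

theorem smoothBump_of_ge {t : ℝ} (h : b ≤ t) (k : ℕ) : smoothBump a b k t = 0 := by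
  rw [smoothBump, Real.smoothTransition.zero_of_nonpos (x := k * (b - t)), mul_zero]
  exact mul_nonpos_of_nonneg_of_nonpos k.cast_nonneg (by linarith)

theorem tendsto_smoothTransition_nat_mul {c : ℝ} (hc : 0 < c) :
    Tendsto (fun k : ℕ => Real.smoothTransition (k * c)) atTop (𝓝 1) := by
  refine tendsto_const_nhds.congr' ?_
  have : Tendsto (fun k : ℕ => (k : ℝ) * c) atTop atTop :=
    tendsto_natCast_atTop_atTop.atTop_mul_const hc
  filter_upwards [this.eventually_ge_atTop 1] with k hk
  exact (Real.smoothTransition.one_of_one_le hk).symm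

theorem tendsto_smoothBump (t : ℝ) :
    Tendsto (fun k => smoothBump a b k t) atTop (𝓝 ((Ioo a b).indicator 1 t)) := by
  by_cases h : t ∈ Ioo a b
  · rw [indicator_of_mem h, Pi.one_apply, ← one_mul (1 : ℝ)]
    exact (tendsto_smoothTransition_nat_mul (sub_pos.2 h.1)).mul
      (tendsto_smoothTransition_nat_mul (sub_pos.2 h.2))
  · rw [indicator_of_notMem h]
    refine tendsto_const_nhds.congr fun k => ?_
    rw [mem_Ioo, not_and_or, not_lt, not_lt] at h
    rcases h with h | h
    · exact (smoothBump_of_le h k).symm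
    · exact (smoothBump_of_ge h k).symm

/-- The truncated power `t ^ (-m - 1)` on `(a, b)`. -/
def cutPow (m a b : ℝ) (k : ℕ) (t : ℝ) : ℝ := t ^ (-m - 1) * smoothBump a b k t

variable {m : ℝ}

/-- The singularity of the power at `0` is harmless, because the bump vanishes on `(-∞, a]` and `a >
0`. -/
theorem contDiff_cutPow (ha : 0 < a) (k : ℕ) : ContDiff ℝ ∞ (cutPow m a b k) := by
  rw [contDiff_iff_contDiffAt]
  intro t
  rcases lt_or_ge t a with h | h
  · have : cutPow m a b k =ᶠ[𝓝 t] fun _ => 0 := by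
      filter_upwards [Iio_mem_nhds h] with s hs
      rw [cutPow, smoothBump_of_le (le_of_lt hs), mul_zero]
    exact contDiffAt_const.congr_of_eventuallyEq this
  · exact (Real.contDiffAt_rpow_const_of_ne (ha.trans_le h).ne').mul
      (contDiff_smoothBump k).contDiffAt

theorem cutPow_of_le {t : ℝ} (h : t ≤ a) (k : ℕ) : cutPow m a b k t = 0 := by
  rw [cutPow, smoothBump_of_le h, mul_zero]

theorem cutPow_of_ge {t : ℝ} (h : b ≤ t) (k : ℕ) : cutPow m a b k t = 0 := by
  rw [cutPow, smoothBump_of_ge h, mul_zero]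

theorem abs_cutPow_le (ha : 0 < a) (hm : 0 ≤ m) (k : ℕ) (t : ℝ) :
    |cutPow m a b k t| ≤ a ^ (-m - 1) := by
  rcases lt_or_ge t a with h | h
  · rw [cutPow_of_le h.le, abs_zero]
    positivity
  · have ht : 0 < t := ha.trans_le h
    rw [cutPow, abs_mul, abs_of_nonneg (smoothBump_nonneg k t), abs_of_nonneg (by positivity)]
    calc t ^ (-m - 1) * smoothBump a b k t ≤ t ^ (-m - 1) * 1 :=
          mul_le_mul_of_nonneg_left (smoothBump_le_one k t) (by positivity)
      _ ≤ a ^ (-m - 1) := by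
          rw [mul_one]
          exact Real.rpow_le_rpow_of_nonpos ha h (by linarith)

theorem tendsto_cutPow (t : ℝ) : Tendsto (fun k => cutPow m a b k t) atTop
    (𝓝 ((Ioo a b).indicator (fun s => s ^ (-m - 1)) t)) := by
  have := (tendsto_smoothBump (a := a) (b := b) t).const_mul (t ^ (-m - 1))
  have e : (Ioo a b).indicator (fun s => s ^ (-m - 1)) t =
      t ^ (-m - 1) * (Ioo a b).indicator 1 t := by
    by_cases h : t ∈ Ioo a b
    · rw [indicator_of_mem h, indicator_of_mem h, Pi.one_apply, mul_one]
    · rw [indicator_of_notMem h, indicator_of_notMem h, mul_zero]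
  rw [e]
  exact this

/-- The radial profile with derivative `-cutPow`, vanishing beyond `b`. -/
def cutProfile (m a b : ℝ) (k : ℕ) (t : ℝ) : ℝ := ∫ s in t..b, cutPow m a b k s

theorem hasDerivAt_cutProfile (ha : 0 < a) (k : ℕ) (t : ℝ) :
    HasDerivAt (cutProfile m a b k) (-cutPow m a b k t) t := by
  have hc : Continuous (cutPow m a b k) := (contDiff_cutPow ha k).continuous
  exact intervalIntegral.integral_hasDerivAt_left (hc.intervalIntegrable _ _)
    (hc.stronglyMeasurableAtFilter _ _) hc.continuousAt

theorem deriv_cutProfile (ha : 0 < a) (k : ℕ) (t : ℝ) :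
    deriv (cutProfile m a b k) t = -cutPow m a b k t := (hasDerivAt_cutProfile ha k t).deriv

theorem contDiff_cutProfile (ha : 0 < a) (k : ℕ) : ContDiff ℝ ∞ (cutProfile m a b k) := by
  rw [contDiff_infty_iff_deriv]
  refine ⟨fun t => (hasDerivAt_cutProfile ha k t).differentiableAt, ?_⟩
  rw [funext (deriv_cutProfile ha k)]
  exact (contDiff_cutPow ha k).neg

theorem cutProfile_of_ge {t : ℝ} (h : b ≤ t) (k : ℕ) : cutProfile m a b k t = 0 := by
  rw [cutProfile, intervalIntegral.integral_congr (g := fun _ => (0 : ℝ)),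
    intervalIntegral.integral_zero]
  intro s hs
  rw [uIcc_of_ge h] at hs
  exact cutPow_of_ge hs.1 k

theorem abs_cutProfile_le (ha : 0 < a) (hm : 0 ≤ m) (k : ℕ) {t : ℝ} (ht : 0 ≤ t) (htb : t ≤ b) :
    |cutProfile m a b k t| ≤ a ^ (-m - 1) * b := by
  have := intervalIntegral.norm_integral_le_of_norm_le_const (a := t) (b := b)
    (f := cutPow m a b k) (C := a ^ (-m - 1)) fun s _ => abs_cutPow_le ha hm k s
  rw [abs_of_nonneg (by linarith)] at this
  exact this.trans (mul_le_mul_of_nonneg_left (by linarith) (by positivity))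

/-- Keeping the factor `m` with the integral covers dimension two: for `m = 0` the profile itself is
logarithmic in the limit, but both sides here vanish. -/
theorem tendsto_mul_cutProfile (ha : 0 < a) (hm : 0 ≤ m) (hab : a < b) {t : ℝ} (htb : t < b) :
    Tendsto (fun k => m * cutProfile m a b k t) atTop (𝓝 (max t a ^ (-m) - b ^ (-m))) := by
  have h1 : Tendsto (fun k => cutProfile m a b k t) atTop
      (𝓝 (∫ s in t..b, (Ioo a b).indicator (fun s => s ^ (-m - 1)) s)) := by
    refine intervalIntegral.tendsto_integral_filter_of_dominated_convergence
      (fun _ => a ^ (-m - 1)) (Eventually.of_forall fun k => ?_) (Eventually.of_forall fun k => ?_)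
      intervalIntegrable_const (ae_of_all _ fun s _ => tendsto_cutPow s)
    · exact (contDiff_cutPow ha k).continuous.aestronglyMeasurable
    · exact ae_of_all _ fun s _ => abs_cutPow_le ha hm k s
  have hmax : max t a < b := max_lt htb hab
  have hmax0 : 0 < max t a := ha.trans_le (le_max_right _ _)
  have h2 : ∫ s in t..b, (Ioo a b).indicator (fun s => s ^ (-m - 1)) s =
      ∫ s in (max t a)..b, s ^ (-m - 1) := by
    rw [intervalIntegral.integral_of_le htb.le, intervalIntegral.integral_of_le hmax.le,
      setIntegral_indicator measurableSet_Ioo, integral_Ioc_eq_integral_Ioo]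
    congr 2
    ext s
    simp only [mem_inter_iff, mem_Ioc, mem_Ioo, max_lt_iff]
    constructor
    · rintro ⟨⟨h1, _⟩, h2, h3⟩
      exact ⟨⟨h1, h2⟩, h3⟩
    · rintro ⟨⟨h1, h2⟩, h3⟩
      exact ⟨⟨h1, h3.le⟩, h2, h3⟩
  have h3 : m * ∫ s in (max t a)..b, s ^ (-m - 1) = max t a ^ (-m) - b ^ (-m) := by
    rw [← intervalIntegral.integral_const_mul]
    rw [intervalIntegral.integral_eq_sub_of_hasDerivAt (f := fun s => -s ^ (-m))]
    · ring
    · intro s hs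
      rw [uIcc_of_le hmax.le] at hs
      have hs0 : 0 < s := hmax0.trans_le hs.1
      exact (Real.hasDerivAt_rpow_const (p := -m) (Or.inl hs0.ne')).neg.congr_deriv (by ring)
    · refine ContinuousOn.intervalIntegrable fun s hs => ?_
      rw [uIcc_of_le hmax.le] at hs
      have hs0 : 0 < s := hmax0.trans_le hs.1
      exact (continuousAt_const.mul
        (Real.continuousAt_rpow_const _ _ (Or.inl hs0.ne'))).continuousWithinAt
  rw [← h3, ← h2]
  exact h1.const_mul m

end Cutoff


/-! ### The monotonicity formula -/

section Monotonicity

variable {n p : ℕ} {u : Euc n → Euc p} {G : Fin n → Fin p → Euc n → ℝ}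

theorem HasLocL2Deriv.locallyIntegrable_radial (hu : HasLocL2Deriv u G) (y : Euc n) :
    LocallyIntegrable fun x => ∑ j, (∑ i, (x i - y i) * G i j x) ^ 2 := by
  refine locallyIntegrable_finsetSum _ fun j _ => ?_
  have h : ∀ x, (∑ i, (x i - y i) * G i j x) ^ 2 =
      ∑ k, ∑ l, (G k j x * G l j x) * ((x k - y k) * (x l - y l)) := fun x => by
    rw [sq, Finset.sum_mul_sum]
    exact Finset.sum_congr rfl fun k _ => Finset.sum_congr rfl fun l _ => by ring
  simp only [h]
  refine locallyIntegrable_finsetSum _ fun k _ => locallyIntegrable_finsetSum _ fun l _ => ?_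
  have hk := hu.locallyIntegrable_mul k l j
  rw [locallyIntegrable_iff] at hk ⊢
  refine fun K hK => (hk K hK).mul_continuousOn (Continuous.continuousOn ?_) hK
  have hc : ∀ i, Continuous fun x : Euc n => x i - y i := fun i =>
    (EuclideanSpace.proj (𝕜 := ℝ) i).continuous.sub continuous_const
  exact (hc k).mul (hc l)

theorem HasLocL2Deriv.integrableOn_annulus (hu : HasLocL2Deriv u G) (y : Euc n) {σ : ℝ}
    (hσ : 0 < σ) (ρ : ℝ) {q : ℝ} (hq : q ≤ 0) :
    IntegrableOn (fun x => (‖x - y‖ ^ 2) ^ q * ∑ j, (∑ i, (x i - y i) * G i j x) ^ 2)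
      (ball y ρ \ closedBall y σ) := by
  have hA : IntegrableOn (fun x => ∑ j, (∑ i, (x i - y i) * G i j x) ^ 2)
      (ball y ρ \ closedBall y σ) :=
    ((hu.locallyIntegrable_radial y).integrableOn_isCompact
      (isCompact_closedBall y ρ)).mono_set (sdiff_subset.trans ball_subset_closedBall)
  have hnormc : Continuous fun x : Euc n => ‖x - y‖ ^ 2 := by fun_prop
  refine Integrable.bdd_mul (c := (σ ^ 2) ^ q) hA
    (hnormc.measurable.pow_const _).aestronglyMeasurable ?_
  filter_upwards [ae_restrict_mem (measurableSet_ball.diff measurableSet_closedBall)] with x hx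
  have ht : σ < ‖x - y‖ := by simpa [dist_eq_norm] using hx.2
  rw [Real.norm_eq_abs, abs_of_nonneg (by positivity)]
  exact Real.rpow_le_rpow_of_nonpos (by positivity) (by gcongr) hq

/-- The limit of the radial first variation formula along the profiles `cutProfile`, as a
pointwise identity between limits of the integrands. -/
theorem tendsto_radial_integrand {m a b : ℝ} (ha : 0 < a) (hm : 0 ≤ m) (hab : a < b) {t : ℝ}
    (e D : ℝ) :
    Tendsto (fun k => (m * cutProfile m a b k t + t * deriv (cutProfile m a b k) t) * e -
        2 * deriv (cutProfile m a b k) t * D) atTop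
      (𝓝 ((Iic a).indicator (fun _ => a ^ (-m) * e) t -
        (Iio b).indicator (fun _ => b ^ (-m) * e) t +
        2 * (Ioo a b).indicator (fun s => s ^ (-m - 1) * D) t)) := by
  have hd : Tendsto (fun k => deriv (cutProfile m a b k) t) atTop
      (𝓝 (-(Ioo a b).indicator (fun s => s ^ (-m - 1)) t)) := by
    simp only [deriv_cutProfile ha]
    exact (tendsto_cutPow t).neg
  rcases lt_or_ge t b with htb | htb
  · have h := (((tendsto_mul_cutProfile ha hm hab htb).add (hd.const_mul t)).mul_const e).sub
      ((hd.const_mul 2).mul_const D)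
    convert h using 2
    rw [indicator_of_mem (show t ∈ Iio b from htb)]
    rcases le_or_gt t a with hta | hta
    · rw [indicator_of_mem (show t ∈ Iic a from hta),
        indicator_of_notMem (fun h => not_lt.2 hta h.1),
        indicator_of_notMem (fun h => not_lt.2 hta h.1), max_eq_right hta]
      ring
    · rw [indicator_of_notMem (show t ∉ Iic a from not_le.2 hta),
        indicator_of_mem (show t ∈ Ioo a b from ⟨hta, htb⟩),
        indicator_of_mem (show t ∈ Ioo a b from ⟨hta, htb⟩), max_eq_left hta.le]
      -- This cancellation dictates the exponent of the profile: on `(a, b)` the coefficient of the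
      -- energy density reduces to `-b ^ (-m)`.
      have : t * t ^ (-m - 1) = t ^ (-m) := by
        rw [mul_comm, ← Real.rpow_add_one (ha.trans hta).ne', sub_add_cancel]
      rw [← this]
      ring
  · rw [indicator_of_notMem (show t ∉ Iic a from not_le.2 (hab.trans_le htb)),
      indicator_of_notMem (show t ∉ Iio b from not_lt.2 htb),
      indicator_of_notMem (fun h => not_lt.2 htb h.2)]
    refine tendsto_const_nhds.congr fun k => ?_
    rw [deriv_cutProfile ha, cutProfile_of_ge htb, cutPow_of_ge htb]
    simp

/-- The ideal profile has corners at `σ²` and `ρ²`, so the radial first variation is applied to its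
smooth approximations, followed by dominated convergence. -/
theorem IsEnergyMinimizing.integral_annulus_eq {N : Set (Euc p)}
    (hmin : IsEnergyMinimizing univ N u) (hu : HasLocL2Deriv u G) (hn : 2 ≤ n) (y : Euc n)
    {σ ρ : ℝ} (hσ : 0 < σ) (hσρ : σ < ρ) :
    (σ ^ 2) ^ (-(((n : ℝ) - 2) / 2)) * (∫ x in closedBall y σ, ∑ i, ∑ j, G i j x ^ 2) -
      (ρ ^ 2) ^ (-(((n : ℝ) - 2) / 2)) * (∫ x in ball y ρ, ∑ i, ∑ j, G i j x ^ 2) +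
      2 * ∫ x in ball y ρ \ closedBall y σ,
        (‖x - y‖ ^ 2) ^ (-(((n : ℝ) - 2) / 2) - 1) * ∑ j, (∑ i, (x i - y i) * G i j x) ^ 2
      = 0 := by
  set m : ℝ := ((n : ℝ) - 2) / 2 with hmdef
  have hm : 0 ≤ m := by
    have : (2 : ℝ) ≤ n := by exact_mod_cast hn
    rw [hmdef]; linarith
  have hρ : 0 < ρ := hσ.trans hσρ
  set a := σ ^ 2 with ha'
  set b := ρ ^ 2 with hb'
  have ha : 0 < a := by positivity
  have hab : a < b := by rw [ha', hb']; gcongr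
  have hb : 0 < b := ha.trans hab
  set e : Euc n → ℝ := fun x => ∑ i, ∑ j, G i j x ^ 2 with he
  set D : Euc n → ℝ := fun x => ∑ j, (∑ i, (x i - y i) * G i j x) ^ 2 with hD
  have he0 : ∀ x, 0 ≤ e x := fun x => by positivity
  have hD0 : ∀ x, 0 ≤ D x := fun x => by positivity
  have heL : LocallyIntegrable e := hu.locallyIntegrable_energyDensity
  have hDL : LocallyIntegrable D := hu.locallyIntegrable_radial y
  have hK : IsCompact (closedBall y ρ) := isCompact_closedBall _ _
  have heρ : IntegrableOn e (closedBall y ρ) := heL.integrableOn_isCompact hK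
  have hmemσ : ∀ x, x ∈ closedBall y σ ↔ ‖x - y‖ ^ 2 ∈ Iic a := fun x => by
    rw [mem_closedBall, dist_eq_norm, mem_Iic, ha', sq_le_sq₀ (norm_nonneg _) hσ.le]
  have hmemρ : ∀ x, x ∈ ball y ρ ↔ ‖x - y‖ ^ 2 ∈ Iio b := fun x => by
    rw [mem_ball, dist_eq_norm, mem_Iio, hb', sq_lt_sq₀ (norm_nonneg _) hρ.le]
  have hmemann : ∀ x, x ∈ ball y ρ \ closedBall y σ ↔ ‖x - y‖ ^ 2 ∈ Ioo a b := fun x => by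
    rw [Set.mem_sdiff, hmemσ, hmemρ, mem_Ioo, mem_Iic, mem_Iio, not_le, and_comm]
  have hzero : ∀ k : ℕ, ∫ x, ((m * cutProfile m a b k (‖x - y‖ ^ 2) +
      ‖x - y‖ ^ 2 * deriv (cutProfile m a b k) (‖x - y‖ ^ 2)) * e x -
      2 * deriv (cutProfile m a b k) (‖x - y‖ ^ 2) * D x) = 0 := fun k =>
    hmin.integral_radial_eq_zero hu (contDiff_cutProfile ha k)
      (fun t ht => cutProfile_of_ge ht k) y
  have hnormc : Continuous fun x : Euc n => ‖x - y‖ ^ 2 := by fun_prop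
  have hmeas : ∀ k : ℕ, AEStronglyMeasurable (fun x => (m * cutProfile m a b k (‖x - y‖ ^ 2) +
      ‖x - y‖ ^ 2 * deriv (cutProfile m a b k) (‖x - y‖ ^ 2)) * e x -
      2 * deriv (cutProfile m a b k) (‖x - y‖ ^ 2) * D x) volume := by
    intro k
    have h1 : Continuous fun x : Euc n => cutProfile m a b k (‖x - y‖ ^ 2) :=
      (contDiff_cutProfile ha k).continuous.comp hnormc
    have h2 : Continuous fun x : Euc n => deriv (cutProfile m a b k) (‖x - y‖ ^ 2) :=
      ((contDiff_cutProfile ha k).continuous_deriv (by simp)).comp hnormc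
    exact (((continuous_const.mul h1).add (hnormc.mul h2)).aestronglyMeasurable.mul
      heL.aestronglyMeasurable).sub
        ((continuous_const.mul h2).aestronglyMeasurable.mul hDL.aestronglyMeasurable)
  set C := a ^ (-m - 1) with hC
  have hC0 : 0 ≤ C := by positivity
  -- The three constants bound `m η`, `t η'` and the radial term, the last through `D x ≤ b * e x`
  -- on the ball.
  have hbound : ∀ k : ℕ, ∀ x, ‖(m * cutProfile m a b k (‖x - y‖ ^ 2) +
      ‖x - y‖ ^ 2 * deriv (cutProfile m a b k) (‖x - y‖ ^ 2)) * e x -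
      2 * deriv (cutProfile m a b k) (‖x - y‖ ^ 2) * D x‖ ≤
      (closedBall y ρ).indicator (fun x => (m * (C * b) + b * C + 2 * C * b) * e x) x := by
    intro k x
    have hDe : D x ≤ ‖x - y‖ ^ 2 * e x := sum_sq_radial_le y x
    have hd := abs_cutPow_le (b := b) ha hm k (‖x - y‖ ^ 2)
    rw [deriv_cutProfile ha]
    by_cases hx : x ∈ ball y ρ
    · rw [indicator_of_mem (ball_subset_closedBall hx)]
      have htb : ‖x - y‖ ^ 2 < b := (hmemρ x).1 hx
      have ht0 : 0 ≤ ‖x - y‖ ^ 2 := sq_nonneg _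
      have hp := abs_cutProfile_le ha hm k ht0 htb.le
      generalize ‖x - y‖ ^ 2 = t at *
      have hDb : D x ≤ b * e x := hDe.trans (mul_le_mul_of_nonneg_right htb.le (he0 x))
      rw [Real.norm_eq_abs]
      calc _ ≤ |(m * cutProfile m a b k t + t * -cutPow m a b k t) * e x| +
            |2 * -cutPow m a b k t * D x| := abs_sub _ _
        _ = |m * cutProfile m a b k t + t * -cutPow m a b k t| * e x +
            2 * |cutPow m a b k t| * D x := by
          rw [abs_mul, abs_of_nonneg (he0 x), abs_mul, abs_mul, abs_neg, abs_of_nonneg (hD0 x),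
            abs_two]
        _ ≤ (m * (C * b) + b * C) * e x + 2 * C * (b * e x) := by
          refine add_le_add (mul_le_mul_of_nonneg_right ?_ (he0 x))
            (mul_le_mul (by linarith) hDb (hD0 x) (by positivity))
          refine (abs_add_le _ _).trans (add_le_add ?_ ?_)
          · rw [abs_mul, abs_of_nonneg hm]
            exact mul_le_mul_of_nonneg_left hp hm
          · rw [abs_mul, abs_of_nonneg ht0, abs_neg]
            exact mul_le_mul htb.le hd (abs_nonneg _) hb.le
        _ = _ := by ring
    · have htb : b ≤ ‖x - y‖ ^ 2 := not_lt.1 fun h => hx ((hmemρ x).2 h)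
      rw [cutProfile_of_ge htb, cutPow_of_ge htb]
      simp only [mul_zero, neg_zero, add_zero, zero_mul, sub_zero, norm_zero]
      exact indicator_nonneg (fun z _ => mul_nonneg (by positivity) (he0 z)) x
  have hlim := tendsto_integral_of_dominated_convergence _ hmeas
    ((integrable_indicator_iff isClosed_closedBall.measurableSet).2
      (heρ.const_mul (m * (C * b) + b * C + 2 * C * b)))
    (fun k => ae_of_all _ (hbound k))
    (ae_of_all _ fun x => tendsto_radial_integrand ha hm hab (t := ‖x - y‖ ^ 2) (e x) (D x))
  simp only [hzero] at hlim
  have hfin := tendsto_nhds_unique hlim tendsto_const_nhds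
  have hI1 : IntegrableOn (fun x => a ^ (-m) * e x) (closedBall y σ) :=
    (heρ.mono_set (closedBall_subset_closedBall hσρ.le)).const_mul _
  have hI2 : IntegrableOn (fun x => b ^ (-m) * e x) (ball y ρ) :=
    (heρ.mono_set ball_subset_closedBall).const_mul _
  have hmann : MeasurableSet (ball y ρ \ closedBall y σ) :=
    measurableSet_ball.diff measurableSet_closedBall
  have hI3 : IntegrableOn (fun x => (‖x - y‖ ^ 2) ^ (-m - 1) * D x)
      (ball y ρ \ closedBall y σ) :=
    hu.integrableOn_annulus y hσ ρ (by linarith)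
  have hfun : ∀ x, (Iic a).indicator (fun _ => a ^ (-m) * e x) (‖x - y‖ ^ 2) -
        (Iio b).indicator (fun _ => b ^ (-m) * e x) (‖x - y‖ ^ 2) +
        2 * (Ioo a b).indicator (fun s => s ^ (-m - 1) * D x) (‖x - y‖ ^ 2) =
      (closedBall y σ).indicator (fun x => a ^ (-m) * e x) x -
        (ball y ρ).indicator (fun x => b ^ (-m) * e x) x +
        2 * (ball y ρ \ closedBall y σ).indicator
          (fun x => (‖x - y‖ ^ 2) ^ (-m - 1) * D x) x := by
    intro x
    simp only [indicator, hmemσ, hmemρ, hmemann]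
  simp only [hfun] at hfin
  have J1 := (integrable_indicator_iff isClosed_closedBall.measurableSet).2 hI1
  have J2 := (integrable_indicator_iff isOpen_ball.measurableSet).2 hI2
  have J3 := (integrable_indicator_iff hmann).2 hI3
  have e1 := integral_add (J1.sub J2) (J3.const_mul 2)
  have e2 := integral_sub J1 J2
  simp only [Pi.sub_apply] at e1
  rw [e1, e2, integral_const_mul, integral_indicator measurableSet_closedBall,
    integral_indicator measurableSet_ball, integral_indicator hmann, integral_const_mul,
    integral_const_mul] at hfin
  exact hfin

theorem norm_radialDeriv_sq (u : Euc n → Euc p) (y x : Euc n) :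
    ‖radialDeriv u y x‖ ^ 2 =
      (‖x - y‖ ^ 2)⁻¹ * ∑ j, (∑ i, (x i - y i) * weakDeriv univ u i j x) ^ 2 := by
  rw [EuclideanSpace.real_norm_sq_eq, Finset.mul_sum]
  refine Finset.sum_congr rfl fun j _ => ?_
  simp only [radialDeriv]
  rw [mul_pow, inv_pow]

theorem sq_rpow_eq_zpow {r : ℝ} (hr : 0 < r) :
    (r ^ 2) ^ (-(((n : ℝ) - 2) / 2)) = r ^ (2 - (n : ℤ)) := by
  rw [← Real.rpow_intCast, ← Real.rpow_natCast, ← Real.rpow_mul hr.le]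
  congr 1
  push_cast
  ring

theorem rpow_mul_radial_eq (u : Euc n → Euc p) {y x : Euc n} (hx : x ≠ y) :
    (‖x - y‖ ^ 2) ^ (-(((n : ℝ) - 2) / 2) - 1) *
        ∑ j, (∑ i, (x i - y i) * weakDeriv univ u i j x) ^ 2 =
      ‖x - y‖ ^ (2 - (n : ℤ)) * ‖radialDeriv u y x‖ ^ 2 := by
  have hr : 0 < ‖x - y‖ := norm_pos_iff.2 (sub_ne_zero.2 hx)
  rw [norm_radialDeriv_sq, ← sq_rpow_eq_zpow hr, Real.rpow_sub_one (by positivity)]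
  ring

/-- The monotonicity formula. -/
theorem IsEnergyMinimizing.scaledEnergy_eq_add {N : Set (Euc p)}
    (hmin : IsEnergyMinimizing univ N u) (hn : 2 ≤ n) (y : Euc n)
    {σ ρ : ℝ} (hσ : 0 < σ) (hσρ : σ < ρ) :
    scaledEnergy u y ρ = scaledEnergy u y σ + 2 * ∫ x in ball y ρ \ closedBall y σ,
      ‖x - y‖ ^ (2 - (n : ℤ)) * ‖radialDeriv u y x‖ ^ 2 := by
  have hu := hmin.1.hasLocL2Deriv
  have h := hmin.integral_annulus_eq hu hn y hσ hσρ
  have hmann : MeasurableSet (ball y ρ \ closedBall y σ) :=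
    measurableSet_ball.diff measurableSet_closedBall
  rw [setIntegral_congr_fun hmann (g := fun x => ‖x - y‖ ^ (2 - (n : ℤ)) *
      ‖radialDeriv u y x‖ ^ 2) (fun x hx => rpow_mul_radial_eq u ?_),
    sq_rpow_eq_zpow hσ, sq_rpow_eq_zpow (hσ.trans hσρ)] at h
  · have hball : ∫ x in closedBall y σ, ∑ i, ∑ j, weakDeriv univ u i j x ^ 2 =
        ∫ x in ball y σ, ∑ i, ∑ j, weakDeriv univ u i j x ^ 2 := by
      refine setIntegral_congr_set ?_
      rw [← ball_union_sphere]
      exact union_ae_eq_left_of_ae_eq_empty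
        (ae_eq_empty.2 (Measure.addHaar_sphere_of_ne_zero _ _ hσ.ne'))
    rw [hball] at h
    rw [scaledEnergy, scaledEnergy, (hu.hasWeakDeriv.restrict_of_univ _).energy_eq isOpen_ball,
      (hu.hasWeakDeriv.restrict_of_univ _).energy_eq isOpen_ball]
    linarith
  · rintro rfl
    exact hx.2 (mem_closedBall_self hσ.le)

end Monotonicity


/-! ### Scaling of the energy at the origin -/

section Homogeneity

variable {n p : ℕ} {u : Euc n → Euc p} {G : Fin n → Fin p → Euc n → ℝ}

theorem smoothInverse_smul {c : ℝ} (hc : c ≠ 0) :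
    SmoothInverse (fun x : Euc n => c • x) (fun x => c⁻¹ • x) :=
  ⟨contDiff_id.const_smul c, contDiff_id.const_smul c⁻¹, fun x => inv_smul_smul₀ hc x,
    fun x => smul_inv_smul₀ hc x⟩

theorem HasWeakDeriv.comp_smul (hu : HasWeakDeriv univ u G) {c : ℝ} (hc : c ≠ 0) :
    HasWeakDeriv univ (fun x => u (c • x)) (fun i j x => c * G i j (c • x)) := by
  have h := (smoothInverse_smul hc).hasWeakDeriv_comp hu
  convert h using 4 with i j x
  have hd : fderiv ℝ (fun x : Euc n => c • x) x = c • ContinuousLinearMap.id ℝ (Euc n) :=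
    ((hasFDerivAt_id x).const_smul c).fderiv
  rw [hd]
  simp [mul_comm]

/-- The scaled energy of a map of homogeneous degree zero about the origin is constant. -/
theorem scaledEnergy_zero_eq (hu : HasLocL2Deriv u G) {c : ℝ} (hc : 0 < c)
    (hom : ∀ᵐ x, u (c • x) = u x) : scaledEnergy u 0 c = scaledEnergy u 0 1 := by
  -- By homogeneity the rescaled gradient is a weak derivative of `u` itself, so the energy of the
  -- unit ball can be read off from the ball of radius `c`.
  have h1 : HasWeakDeriv univ u (fun i j x => c * G i j (c • x)) :=
    (hu.hasWeakDeriv.comp_smul hc.ne').congr_ae hom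
  have e1 : energy (ball 0 1) u = ∫ x in ball (0 : Euc n) 1, ∑ i, ∑ j, (c * G i j (c • x)) ^ 2 :=
    (h1.restrict_of_univ _).energy_eq isOpen_ball
  have e2 : energy (ball 0 c) u = ∫ x in ball (0 : Euc n) c, ∑ i, ∑ j, G i j x ^ 2 :=
    (hu.hasWeakDeriv.restrict_of_univ _).energy_eq isOpen_ball
  have e3 := Measure.setIntegral_comp_smul_of_pos (volume : Measure (Euc n))
    (fun x => ∑ i, ∑ j, G i j x ^ 2) (ball (0 : Euc n) 1) hc
  rw [smul_unitBall_of_pos hc, ← e2, finrank_euclideanSpace, Fintype.card_fin, smul_eq_mul] at e3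
  have e4 : energy (ball 0 1) u = c ^ 2 * ((c ^ n)⁻¹ * energy (ball 0 c) u) := by
    rw [e1, ← e3, ← integral_const_mul]
    congr 1 with x
    simp only [Finset.mul_sum]
    exact Finset.sum_congr rfl fun i _ => Finset.sum_congr rfl fun j _ => by ring
  rw [scaledEnergy, scaledEnergy, e4, one_zpow, one_mul, zpow_sub₀ hc.ne', zpow_natCast]
  rw [show (2 : ℤ) = ((2 : ℕ) : ℤ) from rfl, zpow_natCast]
  ring

end Homogeneity

/-! ### Existence of the density and the final inequality -/

section Density

variable {n p : ℕ} {N : Set (Euc p)} {u : Euc n → Euc p}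

theorem energy_nonneg (Ω : Set (Euc n)) (u : Euc n → Euc p) : 0 ≤ energy Ω u :=
  integral_nonneg fun x => by positivity

theorem scaledEnergy_nonneg (u : Euc n → Euc p) (y : Euc n) {ρ : ℝ} (hρ : 0 < ρ) :
    0 ≤ scaledEnergy u y ρ :=
  mul_nonneg (by positivity) (energy_nonneg _ _)

theorem IsEnergyMinimizing.monotoneOn_scaledEnergy (hmin : IsEnergyMinimizing univ N u)
    (hn : 2 ≤ n) (y : Euc n) : MonotoneOn (scaledEnergy u y) (Ioi 0) := by
  intro σ hσ ρ _ hσρ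
  rcases hσρ.eq_or_lt with rfl | h
  · exact le_rfl
  · rw [hmin.scaledEnergy_eq_add hn y hσ h, le_add_iff_nonneg_right]
    exact mul_nonneg two_pos.le (integral_nonneg fun x => by positivity)

/-- A monotone function bounded below by zero has a right limit at `0`; this gives the `limUnder` in
`density` its meaning. -/
theorem IsEnergyMinimizing.tendsto_scaledEnergy (hmin : IsEnergyMinimizing univ N u)
    (hn : 2 ≤ n) (y : Euc n) :
    Tendsto (scaledEnergy u y) (𝓝[>] 0) (𝓝 (density u y)) := by
  have h : Tendsto (scaledEnergy u y) (𝓝[>] 0) (𝓝 (sInf (scaledEnergy u y '' Ioi 0))) := by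
    refine (hmin.monotoneOn_scaledEnergy hn y).tendsto_nhdsGT ⟨0, ?_⟩
    rintro _ ⟨ρ, hρ, rfl⟩
    exact scaledEnergy_nonneg u y hρ
  exact tendsto_nhds_limUnder ⟨_, h⟩

theorem IsEnergyMinimizing.density_le_scaledEnergy (hmin : IsEnergyMinimizing univ N u)
    (hn : 2 ≤ n) (y : Euc n) {σ : ℝ} (hσ : 0 < σ) : density u y ≤ scaledEnergy u y σ := by
  refine le_of_tendsto (hmin.tendsto_scaledEnergy hn y) ?_
  filter_upwards [Ioo_mem_nhdsGT hσ] with τ hτ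
  exact hmin.monotoneOn_scaledEnergy hn y hτ.1 hσ hτ.2.le

theorem IsDegreeZeroMinimizer.scaledEnergy_zero_eq_density (h : IsDegreeZeroMinimizer N u)
    {ρ : ℝ} (hρ : 0 < ρ) : scaledEnergy u 0 ρ = density u 0 := by
  have hu := h.1.1.hasLocL2Deriv
  have hc : Tendsto (scaledEnergy u 0) (𝓝[>] 0) (𝓝 (scaledEnergy u 0 1)) := by
    refine tendsto_const_nhds.congr' ?_
    filter_upwards [self_mem_nhdsWithin] with c hc
    exact (scaledEnergy_zero_eq hu hc (h.2 c hc)).symm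
  rw [density, hc.limUnder_eq, scaledEnergy_zero_eq hu hρ (h.2 ρ hρ)]

theorem MemW12Loc.energy_ball_mono (h : MemW12Loc univ N u) {y z : Euc n} {r s : ℝ}
    (hb : ball y r ⊆ ball z s) : energy (ball y r) u ≤ energy (ball z s) u := by
  have hu := h.hasLocL2Deriv
  rw [(hu.hasWeakDeriv.restrict_of_univ _).energy_eq isOpen_ball,
    (hu.hasWeakDeriv.restrict_of_univ _).energy_eq isOpen_ball]
  refine setIntegral_mono_set ?_ (ae_of_all _ fun x => by positivity) hb.eventuallyLE
  exact (hu.locallyIntegrable_energyDensity.integrableOn_isCompact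
    (isCompact_closedBall z s)).mono_set ball_subset_closedBall

/-- Enclose the ball in the one of radius `ρ + ‖y‖` about the origin, whose scaled energy is the
density there. The factor compares the two normalizations and tends to one as `ρ → ∞`. -/
theorem IsDegreeZeroMinimizer.scaledEnergy_le (h : IsDegreeZeroMinimizer N u) (hn : 2 ≤ n)
    (y : Euc n) {ρ : ℝ} (hρ : 0 < ρ) :
    scaledEnergy u y ρ ≤ (1 + ‖y‖ / ρ) ^ (n - 2) * density u 0 := by
  have hs : 0 < ρ + ‖y‖ := by positivity
  have hle : energy (ball y ρ) u ≤ energy (ball 0 (ρ + ‖y‖)) u :=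
    h.1.1.energy_ball_mono (ball_subset_ball' (by simp))
  have hz : ∀ r : ℝ, r ^ (2 - (n : ℤ)) = (r ^ (n - 2))⁻¹ := fun r => by
    rw [← zpow_natCast, ← zpow_neg]
    congr 1
    omega
  rw [← h.scaledEnergy_zero_eq_density hs, scaledEnergy, scaledEnergy, hz, hz, ← mul_assoc]
  have e : (1 + ‖y‖ / ρ) ^ (n - 2) * ((ρ + ‖y‖) ^ (n - 2))⁻¹ = (ρ ^ (n - 2))⁻¹ := by
    have : 1 + ‖y‖ / ρ = (ρ + ‖y‖) / ρ := by field_simp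
    rw [this, div_pow]
    field_simp
  rw [e]
  exact mul_le_mul_of_nonneg_left hle (by positivity)

theorem HasLocL2Deriv.integrableOn_annulus_radialDeriv
    (hu : HasLocL2Deriv u (weakDeriv univ u)) (hn : 2 ≤ n) (y : Euc n) {σ : ℝ} (hσ : 0 < σ)
    (ρ : ℝ) :
    IntegrableOn (fun x => ‖x - y‖ ^ (2 - (n : ℤ)) * ‖radialDeriv u y x‖ ^ 2)
      (ball y ρ \ closedBall y σ) := by
  have hn' : (2 : ℝ) ≤ n := by exact_mod_cast hn
  refine (hu.integrableOn_annulus y hσ ρ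
    (q := -(((n : ℝ) - 2) / 2) - 1) (by linarith)).congr_fun (fun x hx => ?_)
    (measurableSet_ball.diff measurableSet_closedBall)
  refine rpow_mul_radial_eq u ?_
  rintro rfl
  exact hx.2 (mem_closedBall_self hσ.le)

/-- Only the point `y` is missed, a null set in positive dimension. The shift by `2` makes the inner
radius smaller than the outer one already at `k = 0`. -/
theorem aecover_annulus (hn : 2 ≤ n) (y : Euc n) :
    AECover volume atTop fun k : ℕ =>
      ball y ((k : ℝ) + 2) \ closedBall y ((k : ℝ) + 2)⁻¹ := by
  have : Nonempty (Fin n) := ⟨⟨0, by omega⟩⟩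
  have : Nontrivial (Euc n) := inferInstance
  refine ⟨?_, fun k => measurableSet_ball.diff measurableSet_closedBall⟩
  have hne : ∀ᵐ x : Euc n, x ≠ y := by
    rw [ae_iff]
    simp
  filter_upwards [hne] with x hx
  have hd : 0 < dist x y := dist_pos.2 hx
  have ht : Tendsto (fun k : ℕ => (k : ℝ) + 2) atTop atTop :=
    tendsto_atTop_add_const_right _ _ tendsto_natCast_atTop_atTop
  filter_upwards [ht.eventually_gt_atTop (dist x y),
    (tendsto_inv_atTop_zero.comp ht).eventually_lt_const hd] with k h1 h2
  exact ⟨h1, not_le.2 h2⟩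

/-- On each annulus the inner scaled energy is at least the density at `y`, and the outer one is
controlled by the density at `0`. Uniform bounds on nonnegative integrals give integrability, and
the limit gives the sharp constant. -/
theorem IsDegreeZeroMinimizer.integrable_and_le (h : IsDegreeZeroMinimizer N u) (hn : 2 ≤ n)
    (y : Euc n) :
    Integrable (fun x : Euc n => ‖x - y‖ ^ (2 - (n : ℤ)) * ‖radialDeriv u y x‖ ^ 2) ∧
      2 * (∫ x : Euc n, ‖x - y‖ ^ (2 - (n : ℤ)) * ‖radialDeriv u y x‖ ^ 2) + density u y
        ≤ density u 0 := by
  have hu := h.1.1.hasLocL2Deriv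
  set F : Euc n → ℝ := fun x => ‖x - y‖ ^ (2 - (n : ℤ)) * ‖radialDeriv u y x‖ ^ 2 with hF
  have hF0 : ∀ x, 0 ≤ F x := fun x => by positivity
  have hcover := aecover_annulus hn y
  have hpos : ∀ k : ℕ, (0 : ℝ) < (k : ℝ) + 2 := fun k => by positivity
  have hlt : ∀ k : ℕ, ((k : ℝ) + 2)⁻¹ < (k : ℝ) + 2 := fun k =>
    (inv_lt_one_of_one_lt₀ (by linarith [hpos k, k.cast_nonneg (α := ℝ)])).trans
      (by linarith [k.cast_nonneg (α := ℝ)])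
  have hle : ∀ k : ℕ, 2 * (∫ x in ball y ((k : ℝ) + 2) \ closedBall y ((k : ℝ) + 2)⁻¹, F x) +
      density u y ≤ (1 + ‖y‖ / ((k : ℝ) + 2)) ^ (n - 2) * density u 0 := by
    intro k
    have h1 := h.1.scaledEnergy_eq_add hn y (inv_pos.2 (hpos k)) (hlt k)
    have h2 := h.1.density_le_scaledEnergy hn y (inv_pos.2 (hpos k))
    have h3 := h.scaledEnergy_le hn y (hpos k)
    linarith
  have ht : Tendsto (fun k : ℕ => (k : ℝ) + 2) atTop atTop :=
    tendsto_atTop_add_const_right _ _ tendsto_natCast_atTop_atTop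
  have hlim : Tendsto (fun k : ℕ => (1 + ‖y‖ / ((k : ℝ) + 2)) ^ (n - 2) * density u 0) atTop
      (𝓝 (density u 0)) := by
    have h1 : Tendsto (fun k : ℕ => ‖y‖ / ((k : ℝ) + 2)) atTop (𝓝 0) := ht.const_div_atTop _
    have h2 := ((h1.const_add 1).pow (n - 2)).mul_const (density u 0)
    simpa using h2
  have hint : Integrable F := by
    -- The upper bounds converge to `density u 0`, so they are eventually below `density u 0 + 1`;
    -- any constant above the limit would do.
    refine hcover.integrable_of_integral_norm_bounded
      ((density u 0 + 1 - density u y) / 2)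
      (fun k => hu.integrableOn_annulus_radialDeriv hn y (inv_pos.2 (hpos k)) _) ?_
    filter_upwards [hlim.eventually_lt_const (lt_add_one _)] with k hk
    have h1 := hle k
    have h2 : ∀ x, ‖F x‖ = F x := fun x => Real.norm_of_nonneg (hF0 x)
    simp only [h2]
    linarith
  refine ⟨hint, le_of_tendsto_of_tendsto' ?_ hlim hle⟩
  exact ((hcover.integral_tendsto_of_countably_generated hint).const_mul 2).add_const _

end Density

end

/-- Here `N = range ι` is a compact smooth manifold embedded in `ℝᵖ`, with the induced metric. -/
theorem theorem4 {n p d : ℕ} (hn : 2 ≤ n)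
    {M : Type*} [TopologicalSpace M] [ChartedSpace (EuclideanSpace ℝ (Fin d)) M]
    [IsManifold (𝓡 d) ∞ M] [CompactSpace M]
    (ι : M → Euc p) (hι : Manifold.IsSmoothEmbedding (𝓡 d) 𝓘(ℝ, Euc p) ∞ ι)
    (φ : Euc n → Euc p) (hφ : IsDegreeZeroMinimizer (range ι) φ) :
    (∀ y : Euc n, Tendsto (scaledEnergy φ y) (𝓝[>] 0) (𝓝 (density φ y))) ∧
    (∀ y : Euc n, density φ y ≤ density φ 0) ∧
    (∀ y : Euc n,
      Integrable (fun x : Euc n => ‖x - y‖ ^ (2 - (n : ℤ)) * ‖radialDeriv φ y x‖ ^ 2) ∧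
      2 * (∫ x : Euc n, ‖x - y‖ ^ (2 - (n : ℤ)) * ‖radialDeriv φ y x‖ ^ 2) + density φ y
        ≤ density φ 0) := by
  exact ⟨fun y => hφ.1.tendsto_scaledEnergy hn y,
    fun y => by
      obtain ⟨-, h⟩ := hφ.integrable_and_le hn y
      have h0 : 0 ≤ ∫ x : Euc n, ‖x - y‖ ^ (2 - (n : ℤ)) * ‖radialDeriv φ y x‖ ^ 2 :=
        integral_nonneg fun x => by positivity
      linarith,
    fun y => hφ.integrable_and_le hn y⟩
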